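/- For every $p\in[3,\infty)$ there is a constant $C_p>0$, depending only on $p$, such that the following holds. Let $E$ be a locally compact separable metric space with its Borel $\sigma$-algebra, and let $m$ be a Radon measure on $E$ with full support. Let $(\mathcal E,\mathcal D(\mathcal E))$ be a regular Dirichlet form on $L^2(E,m)$ which is pure-jump with jumping kernel $J(x,dy)$; that is, $J(x,dy)\,m(dx)$ is a symmetric Radon measure on $\{(x,y)\in E\times E: x\ne y\}$ and $$\mathcal E(u,v)=\frac12\iint_{x\neq y}(u(y)-u(x))(v(y)-v(x))\,J(x,dy)\,m(dx),\qquad u,v\in\mathcal D(\mathcal E).$$ Let $P_t(x,dz)$, $t\ge0$, be an $m$-symmetric transition function on $E$ (jointly measurable in $(t,x)$, sub-Markovian, with $P_0(x,\cdot)=\delta_x$ and satisfying the Chapman–Kolmogorov equations), for instance that of an $m$-symmetric Hunt process, which is associated with $\mathcal E$: with $P_tg(x)=\int_E g(z)\,P_t(x,dz)$, $$\mathcal D(\mathcal E)=\Bigl\{u\in L^2(E,m):\ \lim_{t\to0^+}\tfrac1t\int_E(u-P_tu)\,u\,dm\text{ exists and is finite}\Bigr\},\qquad \mathcal E(u,v)=\lim_{t\to0^+}\tfrac1t\int_E(u-P_tu)\,v\,dm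 .$$ Assume strong stability: $\lim_{T\to\infty}\|P_Tg\|_p=0$ for every $g\in L^p(E,m)$. Put $\chi(s,t)=1$ if $|s|>|t|$, $\chi(s,t)=\frac12$ if $|s|=|t|$, $\chi(s,t)=0$ if $|s|<|t|$, and $$\Gamma[u](x)=\frac12\int_{E\setminus\{x\}}(u(y)-u(x))^2\,J(x,dy),\qquad \widetilde\Gamma[u](x)=\int_{E\setminus\{x\}}(u(y)-u(x))^2\,\chi(u(x),u(y))\,J(x,dy).$$ For $f\in L^p(E,m)$ define the $[0,\infty]$-valued functions $$H(x)=\Bigl(\int_0^\infty P_t\Gamma[P_tf](x)\,dt\Bigr)^{1/2},\qquad \widetilde H(x)=\Bigl(\int_0^\infty P_t\widetilde\Gamma[P_tf](x)\,dt\Bigr)^{1/2}.$$ Then, for every $f\in L^p(E,m)$, $$\|f\|_p\le C_p\,\|\widetilde H\|_p,\qquad \widetilde H\le\sqrt2\,H\ \text{ on } E,\qquad \|f\|_p\le C_p\,\|H\|_p .$$ -/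

import Mathlib

open MeasureTheory ProbabilityTheory Filter Topology
open scoped NNReal ENNReal

noncomputable section

/-- A (symmetric) Dirichlet form on `L²(E, m)`: a densely defined, closed, non-negative definite
symmetric bilinear form on which the unit contraction `u ↦ (0 ∨ u) ∧ 1` operates. -/
structure DirichletForm {E : Type*} [MeasurableSpace E] (m : Measure E) where
  domain : Submodule ℝ (Lp ℝ 2 m)
  form : domain →ₗ[ℝ] domain →ₗ[ℝ] ℝ
  dense : Dense (domain : Set (Lp ℝ 2 m))
  symm : ∀ u v : domain, form u v = form v u
  nonneg : ∀ u : domain, 0 ≤ form u u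
  /-- The domain is complete for the norm `(form u u + ‖u‖²)^(1/2)`. -/
  closed : ∀ u : ℕ → domain,
    (∀ ε : ℝ, 0 < ε → ∃ N : ℕ, ∀ k, N ≤ k → ∀ l, N ≤ l →
      form (u k - u l) (u k - u l) + ‖u k - u l‖ ^ 2 < ε) →
    ∃ v : domain, Tendsto (fun k => form (u k - v) (u k - v) + ‖u k - v‖ ^ 2) atTop (𝓝 0)
  markov : ∀ u : domain, ∃ v : domain,
    ((v : Lp ℝ 2 m) : E → ℝ) =ᵐ[m] (fun x => min (max ((u : Lp ℝ 2 m) x) 0) 1) ∧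
      form v v ≤ form u u

/-- The element `v` of `L²` has a continuous representative `φ` of compact support. -/
def IsRepresentedByCc {E : Type*} [TopologicalSpace E] [MeasurableSpace E] {m : Measure E}
    (v : Lp ℝ 2 m) (φ : E → ℝ) : Prop :=
  Continuous φ ∧ HasCompactSupport φ ∧ (v : E → ℝ) =ᵐ[m] φ

/-- Regularity: `domain ∩ C_c(E)` is dense in the domain for the norm `(form u u + ‖u‖²)^(1/2)`
and dense in `C_c(E)` for the uniform norm. -/
structure DirichletForm.IsRegular {E : Type*} [TopologicalSpace E] [MeasurableSpace E]
    {m : Measure E} (𝓔 : DirichletForm m) : Prop where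
  dense_domain : ∀ u : 𝓔.domain, ∀ ε : ℝ, 0 < ε → ∃ v : 𝓔.domain,
    (∃ φ : E → ℝ, IsRepresentedByCc (v : Lp ℝ 2 m) φ) ∧
      𝓔.form (u - v) (u - v) + ‖u - v‖ ^ 2 < ε
  dense_Cc : ∀ ψ : E → ℝ, Continuous ψ → HasCompactSupport ψ → ∀ ε : ℝ, 0 < ε →
    ∃ v : 𝓔.domain, ∃ φ : E → ℝ,
      IsRepresentedByCc (v : Lp ℝ 2 m) φ ∧ ∀ x, |ψ x - φ x| < ε

/-- The form is pure-jump and `J(x, dy)` is its jumping kernel: `J(x, dy) m(dx)` is a symmetric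
Radon measure off the diagonal, and the form is
`(1/2) ∬_{x ≠ y} (u(y) - u(x)) (v(y) - v(x)) J(x, dy) m(dx)`. The last formula is given for
`u = v` (the general case is its polarization). By symmetry `J(x, dy) m(dx)` does not charge
`N × E` or `E × N` off the diagonal when `m N = 0`, so the choice of the representative of `u`
(for instance a quasi-continuous one) is immaterial. -/
structure DirichletForm.IsPureJump {E : Type*} [TopologicalSpace E] [MeasurableSpace E]
    {m : Measure E} (𝓔 : DirichletForm m) (J : Kernel E E) : Prop where
  radon : ∀ K L : Set E, IsCompact K → IsCompact L → Disjoint K L →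
    ∫⁻ x in K, J x L ∂m < ∞
  symm : ∀ A B : Set E, MeasurableSet A → MeasurableSet B → Disjoint A B →
    ∫⁻ x in A, J x B ∂m = ∫⁻ x in B, J x A ∂m
  form_eq : ∀ u : 𝓔.domain, ENNReal.ofReal (𝓔.form u u) =
    (1 / 2) * ∫⁻ x, ∫⁻ y in {x}ᶜ,
      ENNReal.ofReal (((u : Lp ℝ 2 m) y - (u : Lp ℝ 2 m) x) ^ 2) ∂(J x) ∂m

/-- An `m`-symmetric (normal, jointly measurable, sub-Markovian) transition function
`P_t(x, dz) = ℙ_x(X_t ∈ dz)`, such as that of an `m`-symmetric Hunt process `X`. -/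
structure SymmTransitionFunction {E : Type*} [MeasurableSpace E] (m : Measure E) where
  kernel : Kernel (ℝ≥0 × E) E
  le_one : ∀ t x, kernel (t, x) Set.univ ≤ 1
  zero : ∀ x, kernel (0, x) = Measure.dirac x
  chapman_kolmogorov : ∀ s t x, ∀ B : Set E, MeasurableSet B →
    kernel (s + t, x) B = ∫⁻ z, kernel (t, z) B ∂(kernel (s, x))
  symm : ∀ t, ∀ A B : Set E, MeasurableSet A → MeasurableSet B →
    ∫⁻ x in A, kernel (t, x) B ∂m = ∫⁻ x in B, kernel (t, x) A ∂m

/-- `P_t f (x) = ∫ f(z) P_t(x, dz)` for real `f`; for `f ∈ L^p(E, m)` the integral converges for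
`m`-almost every `x`. -/
def SymmTransitionFunction.op {E : Type*} [MeasurableSpace E] {m : Measure E}
    (P : SymmTransitionFunction m) (t : ℝ≥0) (f : E → ℝ) (x : E) : ℝ :=
  ∫ z, f z ∂(P.kernel (t, x))

/-- `P_t g (x) = ∫ g(z) P_t(x, dz)` for `g` with values in `[0, ∞]`. -/
def SymmTransitionFunction.opENN {E : Type*} [MeasurableSpace E] {m : Measure E}
    (P : SymmTransitionFunction m) (t : ℝ≥0) (g : E → ℝ≥0∞) (x : E) : ℝ≥0∞ :=
  ∫⁻ z, g z ∂(P.kernel (t, x))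

/-- The transition function and the Dirichlet form are associated:
`domain = {u ∈ L² : lim_{t → 0+} (1/t) ∫ (u - P_t u) u dm exists and is finite}` and
`form u v = lim_{t → 0+} (1/t) ∫ (u - P_t u) v dm`. -/
structure SymmTransitionFunction.IsAssociated {E : Type*} [MeasurableSpace E] {m : Measure E}
    (P : SymmTransitionFunction m) (𝓔 : DirichletForm m) : Prop where
  mem_domain_iff : ∀ u : Lp ℝ 2 m, u ∈ 𝓔.domain ↔ ∃ l : ℝ,
    Tendsto (fun t : ℝ≥0 => (1 / (t : ℝ)) * ∫ x, (u x - P.op t u x) * u x ∂m) (𝓝[>] 0) (𝓝 l)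
  form_eq : ∀ u v : 𝓔.domain,
    Tendsto (fun t : ℝ≥0 => (1 / (t : ℝ)) * ∫ x, ((u : Lp ℝ 2 m) x -
      P.op t (u : Lp ℝ 2 m) x) * (v : Lp ℝ 2 m) x ∂m) (𝓝[>] 0) (𝓝 (𝓔.form u v))

/-- Strong stability in `L^p`: `‖P_T f‖_p → 0` as `T → ∞`, for every `f ∈ L^p(E, m)`. -/
def SymmTransitionFunction.StronglyStable {E : Type*} [MeasurableSpace E] {m : Measure E}
    (P : SymmTransitionFunction m) (p : ℝ≥0∞) : Prop :=
  ∀ f : E → ℝ, MemLp f p m → Tendsto (fun T : ℝ≥0 => eLpNorm (P.op T f) p m) atTop (𝓝 0)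

/-- `χ(s, t) = 1_{|s| > |t|} + (1/2) 1_{|s| = |t|}`. -/
def chi (s t : ℝ) : ℝ := if |t| < |s| then 1 else if |s| = |t| then 1 / 2 else 0

/-- The carré du champ `Γ[u](x) = (1/2) ∫_{E ∖ {x}} (u(y) - u(x))² J(x, dy)`. -/
def carreDuChamp {E : Type*} [MeasurableSpace E] (J : Kernel E E) (u : E → ℝ) (x : E) : ℝ≥0∞ :=
  (1 / 2) * ∫⁻ y in {x}ᶜ, ENNReal.ofReal ((u y - u x) ^ 2) ∂(J x)

/-- The modified carré du champ
`Γ̃[u](x) = ∫_{E ∖ {x}} (u(y) - u(x))² χ(u(x), u(y)) J(x, dy)`. -/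
def carreDuChampTilde {E : Type*} [MeasurableSpace E] (J : Kernel E E) (u : E → ℝ) (x : E) :
    ℝ≥0∞ :=
  ∫⁻ y in {x}ᶜ, ENNReal.ofReal ((u y - u x) ^ 2 * chi (u x) (u y)) ∂(J x)

/-- The square function `H(x) = (∫_0^∞ P_t Γ[P_t f](x) dt)^(1/2)`. -/
def squareH {E : Type*} [MeasurableSpace E] {m : Measure E} (P : SymmTransitionFunction m)
    (J : Kernel E E) (f : E → ℝ) (x : E) : ℝ≥0∞ :=
  (∫⁻ t in Set.Ioi (0 : ℝ),
    P.opENN t.toNNReal (carreDuChamp J (P.op t.toNNReal f)) x) ^ (1 / 2 : ℝ)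

/-- The square function `H̃(x) = (∫_0^∞ P_t Γ̃[P_t f](x) dt)^(1/2)`. -/
def squareHTilde {E : Type*} [MeasurableSpace E] {m : Measure E} (P : SymmTransitionFunction m)
    (J : Kernel E E) (f : E → ℝ) (x : E) : ℝ≥0∞ :=
  (∫⁻ t in Set.Ioi (0 : ℝ),
    P.opENN t.toNNReal (carreDuChampTilde J (P.op t.toNNReal f)) x) ^ (1 / 2 : ℝ)

end

/-! Put `u_s = P_s f` and `ψ(s) = ∫ |u_s|^p dm`. Formally `-ψ'(s)` is a jump energy (the Hardy–Stein
identity), comparable with `𝓔(w, w)` for the signed power `w = u_s^{⟨p/2⟩}`. Since `ψ` tends to `0`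
by strong stability, `‖f‖_p^p` is bounded by the time integral of this energy. The elementary bound
`(a^{⟨p/2⟩} - b^{⟨p/2⟩})² ≤ p² (a - b)² max(|a|, |b|)^{p-2}`, with the maximum split by `χ` and the
two halves identified by the symmetry of `J(x, dy) m(dx)`, turns the energy into `∫ |u_s|^{p-2}
Γ̃[u_s] dm`. As `p - 2 ≥ 1`, Jensen gives `|P_t f|^{p-2} ≤ P_t |f|^{p-2}`; symmetry moves `P_t` onto
`Γ̃`, and Tonelli and Hölder yield `‖f‖_p^p ≤ 8p³ ‖f‖_p^{p-2} ‖H̃‖_p²`. Cancelling `‖f‖_p^{p-2}`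
ends the proof. The comparison of `H̃` with `H` is only `χ ≤ 1`.

Neither a generator nor the spectral theorem is used. `jensenGap_le_variance` compares, for each
sub-probability `P_h(x, ·)`, the Jensen gap of `|·|^p` with the variance of the signed power;
integrated, it compares the decay of `ψ` with the `L²` decay of `w` (`integral_abs_rpow_op`). By
symmetry of `P_t` the quotients `(‖w‖² - ‖P_h w‖²)/h` decrease in `h`. The monotone `ψ` is
differentiable almost everywhere; at such a time `w` lies in the domain and `ψ(s) - ψ(s+h) ≤ 4p h
𝓔(w, w)` for every `h > 0` (`ae_powerNorm_sub_le`). These finite increments are integrated instead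
of the derivative, so absolute continuity of `ψ` is not needed. -/

/-! ### Signed powers and the Bregman divergence of `|·|^p`. -/

/-- The signed power `sign(a) |a|^r`. -/
noncomputable def signedPow (r a : ℝ) : ℝ := if 0 ≤ a then a ^ r else -(-a) ^ r

theorem signedPow_of_nonneg {r a : ℝ} (ha : 0 ≤ a) : signedPow r a = a ^ r := if_pos ha

theorem signedPow_neg {r : ℝ} (hr : 0 < r) (a : ℝ) : signedPow r (-a) = -signedPow r a := by
  unfold signedPow
  rcases lt_trichotomy a 0 with h | h | h
  · rw [if_pos (by linarith), if_neg (by linarith), neg_neg]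
  · simp [h, Real.zero_rpow hr.ne']
  · rw [if_neg (by linarith), if_pos h.le, neg_neg]

theorem abs_signedPow (r a : ℝ) : |signedPow r a| = |a| ^ r := by
  unfold signedPow
  split_ifs with h
  · rw [abs_of_nonneg (Real.rpow_nonneg h r), abs_of_nonneg h]
  · have h' : 0 ≤ -a := by linarith
    rw [abs_neg, abs_of_nonneg (Real.rpow_nonneg h' r), abs_of_neg (by linarith)]

theorem measurable_signedPow (r : ℝ) : Measurable (signedPow r) := by
  unfold signedPow
  refine Measurable.ite measurableSet_Ici ?_ ?_ <;> fun_prop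

theorem signedPow_half_sq (p a : ℝ) : signedPow (p / 2) a ^ 2 = |a| ^ p := by
  rw [← sq_abs, abs_signedPow, ← Real.rpow_natCast, ← Real.rpow_mul (abs_nonneg a)]
  congr 1
  push_cast
  ring

theorem signedPow_signedPow_inv {r : ℝ} (hr : 0 < r) (a : ℝ) :
    signedPow r (signedPow r⁻¹ a) = a := by
  have key : ∀ b : ℝ, 0 ≤ b → signedPow r (signedPow r⁻¹ b) = b := fun b hb => by
    rw [signedPow_of_nonneg hb, signedPow_of_nonneg (Real.rpow_nonneg hb _),
      Real.rpow_inv_rpow hb hr.ne']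
  rcases le_total 0 a with h | h
  · exact key a h
  · have := key (-a) (by linarith)
    rw [signedPow_neg (inv_pos.2 hr), signedPow_neg hr] at this
    linarith

theorem signedPow_sub_one_mul {p : ℝ} (hp : 1 < p) (a : ℝ) : signedPow (p - 1) a * a = |a| ^ p := by
  have key : ∀ b : ℝ, 0 ≤ b → signedPow (p - 1) b * b = |b| ^ p := fun b hb => by
    rw [signedPow_of_nonneg hb, abs_of_nonneg hb]
    rcases hb.eq_or_lt with rfl | hb'
    · simp [Real.zero_rpow (by linarith : p ≠ 0)]
    · rw [Real.rpow_sub_one hb'.ne']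
      field_simp
  rcases le_total 0 a with h | h
  · exact key a h
  · have := key (-a) (by linarith)
    rw [signedPow_neg (by linarith), abs_neg] at this
    linarith

/-- The Bregman divergence `|a|^p - |b|^p - p b^{⟨p-1⟩} (a - b)` of `|·|^p`. -/
noncomputable def bregman (p b a : ℝ) : ℝ :=
  |a| ^ p - p * signedPow (p - 1) b * a + (p - 1) * |b| ^ p

theorem bregman_neg {p : ℝ} (hp : 1 < p) (b a : ℝ) : bregman p (-b) (-a) = bregman p b a := by
  simp only [bregman, abs_neg, signedPow_neg (show 0 < p - 1 by linarith)]
  ring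

theorem rpow_half_mul_self {p a : ℝ} (ha : 0 ≤ a) : a ^ (p / 2) * a ^ (p / 2) = a ^ p := by
  rw [← Real.mul_rpow ha ha, ← pow_two, ← Real.rpow_natCast, ← Real.rpow_mul ha]
  congr 1
  push_cast
  ring

theorem rpow_sub_one_mul_self {p a : ℝ} (hp : 1 < p) (ha : 0 ≤ a) : a ^ (p - 1) * a = a ^ p := by
  have := signedPow_sub_one_mul hp a
  rwa [signedPow_of_nonneg ha, abs_of_nonneg ha] at this

/-- Young's inequality between mixed powers. -/
theorem mul_rpow_sub_one_le {p a b : ℝ} (hp : 2 ≤ p) (ha : 0 ≤ a) (hb : 0 ≤ b) :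
    p * (b ^ (p - 1) * a) ≤ 2 * (a ^ (p / 2) * b ^ (p / 2)) + (p - 2) * b ^ p := by
  have hp0 : 0 < p := by linarith
  -- The weights are those for which the geometric mean of `(ab)^{p/2}` and `b^p` is `b^{p-1} a`.
  have h := Real.geom_mean_le_arith_mean2_weighted (w₁ := 2 / p) (w₂ := (p - 2) / p)
    (p₁ := a ^ (p / 2) * b ^ (p / 2)) (p₂ := b ^ p) (by positivity)
    (div_nonneg (by linarith) hp0.le) (by positivity) (by positivity) (by field_simp; ring)
  have e : (a ^ (p / 2) * b ^ (p / 2)) ^ (2 / p) * (b ^ p) ^ ((p - 2) / p) = b ^ (p - 1) * a := by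
    rw [Real.mul_rpow (by positivity) (by positivity), ← Real.rpow_mul ha, ← Real.rpow_mul hb,
      ← Real.rpow_mul hb, show p / 2 * (2 / p) = 1 by field_simp,
      show p * ((p - 2) / p) = p - 2 by field_simp, Real.rpow_one, Real.rpow_one,
      show p - 1 = 1 + (p - 2) by ring]
    rcases hb.eq_or_lt with rfl | hb'
    · rw [Real.zero_rpow (by linarith : (1 : ℝ) + (p - 2) ≠ 0)]; ring
    · rw [Real.rpow_add hb', Real.rpow_one]; ring
  rw [e] at h
  have := mul_le_mul_of_nonneg_left h hp0.le
  calc p * (b ^ (p - 1) * a) ≤ _ := this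
    _ = _ := by field_simp

/-- For equal signs Young's inequality gives the bound with constant `1`. The factor `2` enters for
opposite signs, through `(x + y)² ≤ 2 (x² + y²)`. -/
theorem signedPow_sub_sq_le_bregman {p : ℝ} (hp : 3 ≤ p) (a b : ℝ) :
    (signedPow (p / 2) a - signedPow (p / 2) b) ^ 2 ≤ 2 * bregman p b a := by
  wlog hb : 0 ≤ b generalizing a b
  · have := this (-a) (-b) (by linarith)
    rw [bregman_neg (by linarith), signedPow_neg (by linarith), signedPow_neg (by linarith)] at this
    calc _ = _ := by ring
      _ ≤ _ := this
  have hB := rpow_half_mul_self (p := p) hb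
  have hb0 : 0 ≤ b ^ (p - 1) := by positivity
  have hbp : 0 ≤ b ^ p := by positivity
  rcases le_total 0 a with ha | ha
  · have hA := rpow_half_mul_self (p := p) ha
    have h := mul_rpow_sub_one_le (by linarith : 2 ≤ p) ha hb
    simp only [bregman, signedPow_of_nonneg ha, signedPow_of_nonneg hb, abs_of_nonneg ha,
      abs_of_nonneg hb]
    nlinarith [sq_nonneg (a ^ (p / 2) - b ^ (p / 2))]
  · obtain ⟨c, rfl⟩ : ∃ c, a = -c := ⟨-a, by ring⟩
    have hc : 0 ≤ c := by linarith
    have hA := rpow_half_mul_self (p := p) hc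
    simp only [bregman, signedPow_neg (show 0 < p / 2 by linarith), signedPow_of_nonneg hc,
      signedPow_of_nonneg hb, abs_neg, abs_of_nonneg hc, abs_of_nonneg hb]
    have h1 : 0 ≤ p * b ^ (p - 1) * c := by positivity
    nlinarith [sq_nonneg (c ^ (p / 2) - b ^ (p / 2)), mul_nonneg (by linarith : 0 ≤ p - 2) hbp]

theorem bregman_nonneg {p : ℝ} (hp : 3 ≤ p) (b a : ℝ) : 0 ≤ bregman p b a := by
  nlinarith [signedPow_sub_sq_le_bregman hp a b,
    sq_nonneg (signedPow (p / 2) a - signedPow (p / 2) b)]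

/-- For equal signs, add the non-negative divergence with `a` and `b` exchanged: the sum is `p (a^p
+ b^p - a^{p-1} b - b^{p-1} a)`, and the two mixed terms, whose product is `(ab)^p`, add up to at
least `2 (ab)^{p/2}`. For opposite signs no cancellation occurs and the mixed term is at most the
sum of the pure powers. -/
theorem bregman_le_signedPow_sub_sq {p : ℝ} (hp : 3 ≤ p) (a b : ℝ) :
    bregman p b a ≤ 2 * p * (signedPow (p / 2) a - signedPow (p / 2) b) ^ 2 := by
  wlog hb : 0 ≤ b generalizing a b
  · have := this (-a) (-b) (by linarith)
    rw [bregman_neg (by linarith), signedPow_neg (by linarith), signedPow_neg (by linarith)] at this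
    calc _ ≤ _ := this
      _ = _ := by ring
  have hB := rpow_half_mul_self (p := p) hb
  have hbp : 0 ≤ b ^ p := by positivity
  rcases le_total 0 a with ha | ha
  · have hA := rpow_half_mul_self (p := p) ha
    have h := bregman_nonneg hp a b
    simp only [bregman, signedPow_of_nonneg ha, signedPow_of_nonneg hb, abs_of_nonneg ha,
      abs_of_nonneg hb] at h ⊢
    have hA' := rpow_sub_one_mul_self (by linarith : 1 < p) ha
    have hB' := rpow_sub_one_mul_self (by linarith : 1 < p) hb
    have hx : a ^ (p - 1) * b * (b ^ (p - 1) * a) = a ^ p * b ^ p := by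
      rw [← hA', ← hB']; ring
    have hy : 2 * (a ^ (p / 2) * b ^ (p / 2)) ≤ a ^ (p - 1) * b + b ^ (p - 1) * a := by
      refine le_of_sq_le_sq ?_ (by positivity)
      have : (a ^ (p / 2) * b ^ (p / 2)) ^ 2 = a ^ p * b ^ p := by
        rw [← hA, ← hB]; ring
      nlinarith [sq_nonneg (a ^ (p - 1) * b - b ^ (p - 1) * a)]
    have hz : 2 * (a ^ (p / 2) * b ^ (p / 2)) ≤ a ^ p + b ^ p := by
      nlinarith [sq_nonneg (a ^ (p / 2) - b ^ (p / 2))]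
    have hw : 0 ≤ p * (a ^ p + b ^ p + a ^ (p - 1) * b + b ^ (p - 1) * a
        - 4 * (a ^ (p / 2) * b ^ (p / 2))) := mul_nonneg (by linarith) (by linarith)
    have he : (a ^ (p / 2) - b ^ (p / 2)) ^ 2
        = a ^ p + b ^ p - 2 * (a ^ (p / 2) * b ^ (p / 2)) := by
      rw [← hA, ← hB]; ring
    rw [he]
    linarith
  · obtain ⟨c, rfl⟩ : ∃ c, a = -c := ⟨-a, by ring⟩
    have hc : 0 ≤ c := by linarith
    have hA := rpow_half_mul_self (p := p) hc
    simp only [bregman, signedPow_neg (show 0 < p / 2 by linarith), signedPow_of_nonneg hc,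
      signedPow_of_nonneg hb, abs_neg, abs_of_nonneg hc, abs_of_nonneg hb]
    have hcp : 0 ≤ c ^ p := by positivity
    have hm : b ^ (p - 1) * c ≤ b ^ p + c ^ p := by
      rcases le_total b c with h | h
      · have : b ^ (p - 1) * c ≤ c ^ (p - 1) * c :=
          mul_le_mul_of_nonneg_right (Real.rpow_le_rpow hb h (by linarith)) hc
        rw [rpow_sub_one_mul_self (by linarith) hc] at this
        linarith
      · have : b ^ (p - 1) * c ≤ b ^ (p - 1) * b := mul_le_mul_of_nonneg_left h (by positivity)
        rw [rpow_sub_one_mul_self (by linarith) hb] at this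
        linarith
    have he : (-c ^ (p / 2) - b ^ (p / 2)) ^ 2
        = c ^ p + b ^ p + 2 * (c ^ (p / 2) * b ^ (p / 2)) := by
      rw [← hA, ← hB]; ring
    rw [he]
    have h1 : 0 ≤ p * (c ^ (p / 2) * b ^ (p / 2)) := by positivity
    have h2 := mul_le_mul_of_nonneg_left hm (by linarith : 0 ≤ p)
    have h3 := mul_nonneg (by linarith : 0 ≤ p - 1) hcp
    linarith

/-- After scaling by the larger of the two numbers, the case of equal signs is Bernoulli's
inequality; for opposite signs the smaller base is replaced by the larger one. -/
theorem abs_signedPow_sub_le {r : ℝ} (hr : 1 ≤ r) (a b : ℝ) :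
    |signedPow r a - signedPow r b| ≤ r * |a - b| * max |a| |b| ^ (r - 1) := by
  wlog hab : |b| ≤ |a| generalizing a b
  · have := this b a (by linarith)
    rwa [abs_sub_comm, max_comm, abs_sub_comm a b]
  wlog ha : 0 ≤ a generalizing a b
  · have := this (-a) (-b) (by simpa using hab) (by linarith)
    rw [signedPow_neg (by linarith), signedPow_neg (by linarith), abs_neg, abs_neg,
      show -signedPow r a - -signedPow r b = -(signedPow r a - signedPow r b) by ring, abs_neg,
      show -a - -b = -(a - b) by ring, abs_neg] at this
    exact this
  rw [max_eq_left hab]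
  rw [abs_of_nonneg ha] at hab ⊢
  have h1 : 0 ≤ a ^ (r - 1) := by positivity
  have haa : a * a ^ (r - 1) = a ^ r := by
    rcases ha.eq_or_lt with rfl | h
    · rw [Real.zero_rpow (by linarith : r ≠ 0)]; ring
    · rw [Real.rpow_sub_one h.ne']; field_simp
  rcases le_total 0 b with hb | hb
  · rw [abs_of_nonneg hb] at hab
    rw [signedPow_of_nonneg ha, signedPow_of_nonneg hb,
      abs_of_nonneg (sub_nonneg.2 (Real.rpow_le_rpow hb hab (by linarith))),
      abs_of_nonneg (by linarith)]
    rcases ha.eq_or_lt with rfl | h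
    · obtain rfl : b = 0 := by linarith
      simp
    · have hB := one_add_mul_self_le_rpow_one_add (s := b / a - 1) (p := r)
        (by linarith [div_nonneg hb ha]) hr
      rw [show 1 + (b / a - 1) = b / a by ring, Real.div_rpow hb ha] at hB
      have := mul_le_mul_of_nonneg_right hB (Real.rpow_nonneg ha r)
      rw [div_mul_cancel₀ _ (Real.rpow_pos_of_pos h r).ne'] at this
      have e : (1 + r * (b / a - 1)) * a ^ r = a ^ r - r * (a - b) * a ^ (r - 1) := by
        rw [← haa]; field_simp; ring
      linarith
  · obtain ⟨c, rfl⟩ : ∃ c, b = -c := ⟨-b, by ring⟩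
    have hc : 0 ≤ c := by linarith
    rw [abs_neg, abs_of_nonneg hc] at hab
    rw [signedPow_neg (by linarith), signedPow_of_nonneg ha, signedPow_of_nonneg hc,
      sub_neg_eq_add, sub_neg_eq_add, abs_of_nonneg (by positivity), abs_of_nonneg (by positivity)]
    have hcc : c * c ^ (r - 1) = c ^ r := by
      rcases hc.eq_or_lt with rfl | h
      · rw [Real.zero_rpow (by linarith : r ≠ 0)]; ring
      · rw [Real.rpow_sub_one h.ne']; field_simp
    have h2 : c * c ^ (r - 1) ≤ c * a ^ (r - 1) :=
      mul_le_mul_of_nonneg_left (Real.rpow_le_rpow hc hab (by linarith)) hc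
    have h3 : 0 ≤ (r - 1) * ((a + c) * a ^ (r - 1)) :=
      mul_nonneg (by linarith) (by positivity)
    linarith

theorem signedPow_half_sub_sq_le {p : ℝ} (hp : 3 ≤ p) (a b : ℝ) :
    (signedPow (p / 2) a - signedPow (p / 2) b) ^ 2
      ≤ p ^ 2 * ((a - b) ^ 2 * max |a| |b| ^ (p - 2)) := by
  have h := abs_signedPow_sub_le (by linarith : 1 ≤ p / 2) a b
  have hm : 0 ≤ max |a| |b| := le_max_of_le_left (abs_nonneg a)
  have e : (max |a| |b| ^ (p / 2 - 1)) ^ 2 = max |a| |b| ^ (p - 2) := by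
    rw [← Real.rpow_natCast, ← Real.rpow_mul hm]
    congr 1
    push_cast
    ring
  calc (signedPow (p / 2) a - signedPow (p / 2) b) ^ 2
      = |signedPow (p / 2) a - signedPow (p / 2) b| ^ 2 := (sq_abs _).symm
    _ ≤ (p / 2 * |a - b| * max |a| |b| ^ (p / 2 - 1)) ^ 2 :=
        pow_le_pow_left₀ (abs_nonneg _) h 2
    _ = (p ^ 2 / 4) * ((a - b) ^ 2 * max |a| |b| ^ (p - 2)) := by
        rw [mul_pow, mul_pow, e, sq_abs]; ring
    _ ≤ p ^ 2 * ((a - b) ^ 2 * max |a| |b| ^ (p - 2)) := by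
        refine mul_le_mul_of_nonneg_right ?_ (by positivity)
        nlinarith [sq_nonneg p]

/-! ### Jensen gaps for sub-probability measures. -/

section SubProbability

variable {α : Type*} [MeasurableSpace α] {μ : Measure α} [IsFiniteMeasure μ] {p : ℝ} {U : α → ℝ}

theorem integrable_of_abs_rpow_le {q : ℝ} (hq : 0 ≤ q) (hqp : q ≤ p)
    {V : α → ℝ} (hV : AEStronglyMeasurable V μ) (hVU : ∀ x, |V x| = |U x| ^ q)
    (hU : Integrable (fun x => |U x| ^ p) μ) : Integrable V μ := by
  refine ((integrable_const (1 : ℝ)).add hU).mono' hV (ae_of_all _ fun x => ?_)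
  rw [Real.norm_eq_abs, hVU]
  simp only [Pi.add_apply]
  have h0 := abs_nonneg (U x)
  rcases le_total |U x| 1 with h | h
  · have := Real.rpow_le_one h0 h hq
    have := Real.rpow_nonneg h0 p
    linarith
  · have := Real.rpow_le_rpow_of_exponent_le h hqp
    linarith

theorem integral_bregman (hU : Integrable U μ)
    (hUp : Integrable (fun x => |U x| ^ p) μ) (b : ℝ) :
    Integrable (fun x => bregman p b (U x)) μ ∧
    ∫ x, bregman p b (U x) ∂μ = ∫ x, |U x| ^ p ∂μ - p * signedPow (p - 1) b * ∫ x, U x ∂μ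
      + (p - 1) * |b| ^ p * μ.real Set.univ := by
  have h1 : Integrable (fun x => p * signedPow (p - 1) b * U x) μ := hU.const_mul _
  have h2 : Integrable (fun x => |U x| ^ p - p * signedPow (p - 1) b * U x) μ := hUp.sub h1
  refine ⟨h2.add (integrable_const _), ?_⟩
  unfold bregman
  rw [integral_add h2 (integrable_const _), integral_sub hUp h1, integral_const_mul,
    integral_const, smul_eq_mul]
  ring

theorem integral_sub_const_sq {W : α → ℝ} (hW : Integrable W μ)
    (hW2 : Integrable (fun x => W x ^ 2) μ) (c : ℝ) :
    Integrable (fun x => (W x - c) ^ 2) μ ∧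
    ∫ x, (W x - c) ^ 2 ∂μ = ∫ x, W x ^ 2 ∂μ - 2 * c * ∫ x, W x ∂μ + c ^ 2 * μ.real Set.univ := by
  have h1 : Integrable (fun x => 2 * c * W x) μ := hW.const_mul _
  have e : (fun x => (W x - c) ^ 2) = fun x => W x ^ 2 - 2 * c * W x + c ^ 2 := by
    ext x; ring
  have h2 : Integrable (fun x => W x ^ 2 - 2 * c * W x) μ := hW2.sub h1
  rw [e]
  refine ⟨h2.add (integrable_const _), ?_⟩
  rw [integral_add h2 (integrable_const _), integral_sub hW2 h1, integral_const_mul,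
    integral_const, smul_eq_mul]
  ring

theorem sq_integral_le_of_measure_le_one {W : α → ℝ} (hμ : μ Set.univ ≤ 1) (hW : Integrable W μ)
    (hW2 : Integrable (fun x => W x ^ 2) μ) : (∫ x, W x ∂μ) ^ 2 ≤ ∫ x, W x ^ 2 ∂μ := by
  have hk : μ.real Set.univ ≤ 1 := ENNReal.toReal_mono ENNReal.one_ne_top hμ
  have h := (integral_sub_const_sq hW hW2 (∫ x, W x ∂μ)).2
  have h0 : 0 ≤ ∫ x, (W x - ∫ x, W x ∂μ) ^ 2 ∂μ := integral_nonneg fun x => sq_nonneg _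
  nlinarith [mul_nonneg (sq_nonneg (∫ x, W x ∂μ)) (sub_nonneg.2 hk)]

/-- For a sub-probability measure, the Jensen gap of `|·|^p` at `U` is comparable with the variance
of the signed power `U^{⟨p/2⟩}`. -/
theorem jensenGap_le_variance (hp : 3 ≤ p) (hμ : μ Set.univ ≤ 1) (hU : AEStronglyMeasurable U μ)
    (hUp : Integrable (fun x => |U x| ^ p) μ) :
    ∫ x, |U x| ^ p ∂μ - |∫ x, U x ∂μ| ^ p
        ≤ 2 * p * (∫ x, |U x| ^ p ∂μ - (∫ x, signedPow (p / 2) (U x) ∂μ) ^ 2) ∧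
      ∫ x, |U x| ^ p ∂μ - (∫ x, signedPow (p / 2) (U x) ∂μ) ^ 2
        ≤ 2 * (∫ x, |U x| ^ p ∂μ - |∫ x, U x ∂μ| ^ p) := by
  have hU1 : Integrable U μ := integrable_of_abs_rpow_le zero_le_one (by linarith) hU
    (fun x => by simp) hUp
  have hW1 : Integrable (fun x => signedPow (p / 2) (U x)) μ :=
    integrable_of_abs_rpow_le (q := p / 2) (by linarith) (by linarith)
    ((measurable_signedPow _).comp_aemeasurable hU.aemeasurable).aestronglyMeasurable
    (fun x => abs_signedPow _ _) hUp
  have hk : μ.real Set.univ ≤ 1 := ENNReal.toReal_mono ENNReal.one_ne_top hμ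
  set k := μ.real Set.univ
  set β := ∫ x, signedPow (p / 2) (U x) ∂μ with hβ
  set I := ∫ x, |U x| ^ p ∂μ
  have hW2 : Integrable (fun x => signedPow (p / 2) (U x) ^ 2) μ := by
    simpa only [signedPow_half_sq] using hUp
  have hW2' : ∫ x, signedPow (p / 2) (U x) ^ 2 ∂μ = I := by simp only [signedPow_half_sq, I]
  constructor
  -- Expand around the `b` whose signed power is the mean `β`, not around the mean of `U`:
  -- non-negativity of `bregman p b (∫ U)` shows that this only enlarges the gap. The missing mass
  -- `1 - k` contributes with a favourable sign.
  · obtain ⟨b, hb⟩ : ∃ b, signedPow (p / 2) b = β :=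
      ⟨_, signedPow_signedPow_inv (by linarith) β⟩
    have hbp : |b| ^ p = β ^ 2 := by rw [← signedPow_half_sq, hb]
    obtain ⟨i1, e1⟩ := integral_bregman hU1 hUp b
    obtain ⟨i2, e2⟩ := integral_sub_const_sq hW1 hW2 β
    have h := integral_mono i1 (i2.const_mul (2 * p)) (fun x => by
      simpa only [hb] using bregman_le_signedPow_sub_sq hp (U x) b)
    rw [integral_const_mul, e1, e2, hbp, hW2', ← hβ] at h
    have h0 := bregman_nonneg hp b (∫ x, U x ∂μ)
    unfold bregman at h0
    rw [hbp] at h0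
    nlinarith [mul_nonneg (sq_nonneg β) (by linarith : 0 ≤ 1 - k),
      mul_nonneg (mul_nonneg (sq_nonneg β) (by linarith : 0 ≤ 1 - k)) (by linarith : 0 ≤ p)]
  -- Now expand around the mean of `U`; putting `γ` in place of the mean `β` of the signed power
  -- costs `(β - γ)² ≥ 0`.
  · set b := ∫ x, U x ∂μ with hb
    have hbp : |b| ^ p = signedPow (p / 2) b ^ 2 := (signedPow_half_sq _ _).symm
    obtain ⟨i1, e1⟩ := integral_bregman hU1 hUp b
    obtain ⟨i2, e2⟩ := integral_sub_const_sq hW1 hW2 (signedPow (p / 2) b)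
    have h := integral_mono i2 (i1.const_mul 2) (fun x => by
      exact signedPow_sub_sq_le_bregman hp (U x) b)
    rw [integral_const_mul, e1, e2, hW2', ← hβ, ← hb, mul_assoc p,
      signedPow_sub_one_mul (by linarith), hbp] at h
    rw [hbp]
    set γ := signedPow (p / 2) b
    nlinarith [mul_nonneg (sq_nonneg γ) (by linarith : 0 ≤ 1 - k), sq_nonneg (β - γ),
      mul_nonneg (mul_nonneg (sq_nonneg γ) (by linarith : 0 ≤ 1 - k)) (by linarith : 0 ≤ p - 3)]

end SubProbability

/-! ### Midpoint convexity; measures determined by rectangles. -/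

/-- A monotone midpoint-convex function on `[0, ∞)` has antitone difference quotients at `0`. -/
theorem Antitone.sub_div_le_of_midpoint {F : ℝ≥0 → ℝ} (hF : Antitone F)
    (hmid : ∀ r s t : ℝ≥0, r + r = s + t → 2 * F r ≤ F s + F t) {s t : ℝ≥0} (hs : 0 < s)
    (hst : s ≤ t) : (F 0 - F t) / t ≤ (F 0 - F s) / s := by
  have ht : 0 < t := hs.trans_le hst
  -- `g` is the deviation of `F` from its chord on `[0, t]`, rescaled to `[0, 1]`. It vanishes at
  -- both ends, so midpoint convexity at least doubles it on passing from `l` to `2l` or `2l - 1`.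
  -- Monotonicity bounds it above by `F 0 - F t`; hence it is never positive, without any continuity
  -- of `F`.
  set g : ℝ≥0 → ℝ := fun l => F (l * t) - (1 - l) * F 0 - l * F t with hg
  have key : ∀ n : ℕ, ∀ l : ℝ≥0, l ≤ 1 → 2 ^ n * g l ≤ F 0 - F t := by
    intro n
    induction n with
    | zero =>
      intro l hl
      have hl' : (l : ℝ) ≤ 1 := by exact_mod_cast hl
      have h1 : F (l * t) ≤ F 0 := hF (zero_le)
      have h2 : F t ≤ F 0 := hF (zero_le)
      simp only [hg]
      nlinarith [l.coe_nonneg]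
    | succ n ih =>
      intro l hl
      have hl' : (l : ℝ) ≤ 1 := by exact_mod_cast hl
      have hp : (0 : ℝ) ≤ 2 ^ n := by positivity
      rcases le_total (2 * l) 1 with h | h
      · have h1 := ih (2 * l) h
        have h2 := hmid (l * t) (2 * l * t) 0 (by ring)
        have h3 : 2 * g l ≤ g (2 * l) := by
          simp only [hg]; push_cast; linarith
        calc (2 : ℝ) ^ (n + 1) * g l = 2 ^ n * (2 * g l) := by ring
          _ ≤ 2 ^ n * g (2 * l) := mul_le_mul_of_nonneg_left h3 hp
          _ ≤ _ := h1
      · have hsub : 2 * l - 1 ≤ 1 := by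
          rw [tsub_le_iff_right]
          calc 2 * l ≤ 2 * 1 := by gcongr
            _ = 1 + 1 := by norm_num
        have h1 := ih (2 * l - 1) hsub
        have h2 := hmid (l * t) ((2 * l - 1) * t) t (by
          calc l * t + l * t = 2 * l * t := by ring
            _ = (2 * l - 1 + 1) * t := by rw [tsub_add_cancel_of_le h]
            _ = _ := by ring)
        have h3 : 2 * g l ≤ g (2 * l - 1) := by
          simp only [hg]; rw [NNReal.coe_sub h]; push_cast; linarith
        calc (2 : ℝ) ^ (n + 1) * g l = 2 ^ n * (2 * g l) := by ring
          _ ≤ 2 ^ n * g (2 * l - 1) := mul_le_mul_of_nonneg_left h3 hp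
          _ ≤ _ := h1
  have hle : g (s / t) ≤ 0 := by
    by_contra! hpos
    obtain ⟨n, hn⟩ := pow_unbounded_of_one_lt ((F 0 - F t) / g (s / t)) (one_lt_two (α := ℝ))
    rw [div_lt_iff₀ hpos] at hn
    exact absurd (key n (s / t) (div_le_one_of_le₀ hst zero_le)) (not_le.2 hn)
  simp only [hg] at hle
  rw [div_mul_cancel₀ _ ht.ne'] at hle
  have hs' : (0 : ℝ) < s := hs
  have ht' : (0 : ℝ) < t := ht
  rw [div_le_div_iff₀ ht' hs']
  push_cast at hle
  have := mul_le_mul_of_nonneg_right hle ht'.le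
  have e : ((F s : ℝ) - (1 - (s : ℝ) / t) * F 0 - s / t * F t) * t
      = F s * t - (t - s) * F 0 - s * F t := by field_simp
  rw [e] at this
  linarith

/-- On each rectangle the measure is finite, hence determined by product sets. This extends the
symmetry of the jump measure, given only on products of disjoint sets, to everything off the
diagonal. -/
theorem MeasureTheory.Measure.ext_of_rectangles {α β ι : Type*} [MeasurableSpace α]
    [MeasurableSpace β] [Countable ι] {μ ν : Measure (α × β)} {A : ι → Set α} {B : ι → Set β}
    (hA : ∀ i, MeasurableSet (A i)) (hB : ∀ i, MeasurableSet (B i))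
    (hfin : ∀ i, μ (A i ×ˢ B i) ≠ ∞)
    (h : ∀ i s t, MeasurableSet s → MeasurableSet t → s ⊆ A i → t ⊆ B i → μ (s ×ˢ t) = ν (s ×ˢ t))
    (hμ : μ (⋃ i, A i ×ˢ B i)ᶜ = 0) (hν : ν (⋃ i, A i ×ˢ B i)ᶜ = 0) : μ = ν := by
  have hμ' : μ.restrict (⋃ i, A i ×ˢ B i) = μ :=
    Measure.restrict_eq_self_of_ae_mem (mem_ae_iff.2 hμ)
  have hν' : ν.restrict (⋃ i, A i ×ˢ B i) = ν :=
    Measure.restrict_eq_self_of_ae_mem (mem_ae_iff.2 hν)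
  rw [← hμ', ← hν', Measure.restrict_iUnion_congr]
  intro i
  have : IsFiniteMeasure (μ.restrict (A i ×ˢ B i)) :=
    ⟨by rw [Measure.restrict_apply_univ]; exact (hfin i).lt_top⟩
  refine Measure.ext_prod fun {s t} hs ht => ?_
  rw [Measure.restrict_apply (hs.prod ht), Measure.restrict_apply (hs.prod ht), Set.prod_inter_prod]
  exact h i _ _ (hs.inter (hA i)) (ht.inter (hB i)) Set.inter_subset_right Set.inter_subset_right

/-! ### The semigroup on functions and its `L²` decay. -/

namespace SymmTransitionFunction

variable {E : Type*} [MeasurableSpace E] {m : Measure E} (P : SymmTransitionFunction m)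

/-- The kernel `P_t(x, dz)` at a fixed time `t`. -/
noncomputable def transition (t : ℝ≥0) : Kernel E E :=
  P.kernel.comap (fun x => (t, x)) measurable_prodMk_left

instance : IsFiniteKernel P.kernel := ⟨1, ENNReal.one_lt_top, fun z => P.le_one z.1 z.2⟩

instance (t : ℝ≥0) : IsFiniteKernel (P.transition t) :=
  ⟨1, ENNReal.one_lt_top, fun x => P.le_one t x⟩

theorem op_eq (t : ℝ≥0) (f : E → ℝ) (x : E) : P.op t f x = ∫ z, f z ∂(P.transition t x) := rfl

/-- Symmetry tested against the whole space, together with `P_t 1 ≤ 1`. It makes statements valid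
`m`-almost everywhere survive integration against `P_t(x, ·)`. -/
theorem comp_transition_le (t : ℝ≥0) : (P.transition t) ∘ₘ m ≤ m := by
  refine Measure.le_iff.2 fun B hB => ?_
  rw [Measure.bind_apply hB (Kernel.aemeasurable _)]
  have h := P.symm t Set.univ B MeasurableSet.univ hB
  rw [Measure.restrict_univ] at h
  calc ∫⁻ x, P.kernel (t, x) B ∂m = _ := h
    _ ≤ ∫⁻ _ in B, 1 ∂m := lintegral_mono fun x => P.le_one t x
    _ = m B := by simp

theorem map_swap_compProd [SigmaFinite m] (t : ℝ≥0) :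
    (m ⊗ₘ P.transition t).map Prod.swap = m ⊗ₘ P.transition t := by
  have hrect : ∀ s u, MeasurableSet s → MeasurableSet u →
      (m ⊗ₘ P.transition t).map Prod.swap (s ×ˢ u) = (m ⊗ₘ P.transition t) (s ×ˢ u) := by
    intro s u hs hu
    rw [Measure.map_apply measurable_swap (hs.prod hu), Set.preimage_swap_prod,
      Measure.compProd_apply_prod hu hs, Measure.compProd_apply_prod hs hu]
    exact P.symm t u s hu hs
  have hU : (⋃ i : ℕ, spanningSets m i ×ˢ (Set.univ : Set E)) = Set.univ := by
    rw [← Set.iUnion_prod_const, iUnion_spanningSets, Set.univ_prod_univ]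
  refine Measure.ext_of_rectangles (A := fun i : ℕ => spanningSets m i) (B := fun _ => Set.univ)
    (fun i => measurableSet_spanningSets m i) (fun _ => MeasurableSet.univ) (fun i => ?_)
    (fun i s u hs hu _ _ => hrect s u hs hu) (by rw [hU]; simp) (by rw [hU]; simp)
  rw [hrect _ _ (measurableSet_spanningSets m i) MeasurableSet.univ,
    Measure.compProd_apply_prod (measurableSet_spanningSets m i) MeasurableSet.univ]
  refine (lt_of_le_of_lt (lintegral_mono fun x => P.le_one t x) ?_).ne
  simpa using measure_spanningSets_lt_top m i

theorem ae_ae_transition {q : E → Prop} (h : ∀ᵐ x ∂m, q x) (t : ℝ≥0) :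
    ∀ᵐ x ∂m, ∀ᵐ z ∂(P.transition t x), q z :=
  Measure.ae_ae_of_ae_comp (ae_mono (P.comp_transition_le t) h)

theorem op_congr {f g : E → ℝ} (h : f =ᵐ[m] g) (t : ℝ≥0) : P.op t f =ᵐ[m] P.op t g := by
  filter_upwards [P.ae_ae_transition h t] with x hx using integral_congr_ae hx

theorem measurable_op_uncurry {f : E → ℝ} (hf : Measurable f) :
    Measurable fun z : ℝ≥0 × E => P.op z.1 f z.2 :=
  (hf.stronglyMeasurable.integral_kernel (κ := P.kernel)).measurable

theorem measurable_op {f : E → ℝ} (hf : Measurable f) (t : ℝ≥0) : Measurable (P.op t f) :=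
  (P.measurable_op_uncurry hf).comp measurable_prodMk_left

theorem op_zero {f : E → ℝ} (hf : Measurable f) : P.op 0 f = f := by
  ext x
  rw [op, P.zero, integral_dirac' _ _ hf.stronglyMeasurable]

theorem ae_integrable_transition {f : E → ℝ} (hf : Integrable f m) (t : ℝ≥0) :
    ∀ᵐ x ∂m, Integrable f (P.transition t x) :=
  Measure.ae_integrable_of_integrable_comp (hf.mono_measure (P.comp_transition_le t))

theorem integrable_op {f : E → ℝ} (hm : Measurable f) (hf : Integrable f m) (t : ℝ≥0) :
    Integrable (P.op t f) m :=
  (Measure.integrable_integral_norm_of_integrable_comp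
    (hf.mono_measure (P.comp_transition_le t))).mono' (P.measurable_op hm t).aestronglyMeasurable
    (ae_of_all _ fun _ => norm_integral_le_integral_norm _)

theorem integral_op_le {f : E → ℝ} (hm : Measurable f) (hf : Integrable f m) (h0 : ∀ x, 0 ≤ f x)
    (t : ℝ≥0) : ∫ x, P.op t f x ∂m ≤ ∫ x, f x ∂m := by
  have hfc := hf.mono_measure (P.comp_transition_le t)
  rw [integral_eq_lintegral_of_nonneg_ae (f := P.op t f)
      (ae_of_all _ fun x => integral_nonneg h0) (P.measurable_op hm t).aestronglyMeasurable,
    integral_eq_lintegral_of_nonneg_ae (ae_of_all _ h0) hm.aestronglyMeasurable]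
  refine ENNReal.toReal_mono hf.lintegral_lt_top.ne ?_
  calc ∫⁻ x, ENNReal.ofReal (P.op t f x) ∂m
      = ∫⁻ x, ∫⁻ z, ENNReal.ofReal (f z) ∂(P.transition t x) ∂m := by
        refine lintegral_congr_ae ?_
        filter_upwards [P.ae_integrable_transition hf t] with x hx
        exact ofReal_integral_eq_lintegral_ofReal hx (ae_of_all _ h0)
    _ = ∫⁻ z, ENNReal.ofReal (f z) ∂((P.transition t) ∘ₘ m) :=
        (Measure.lintegral_bind (Kernel.aemeasurable _) hm.ennreal_ofReal.aemeasurable).symm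
    _ ≤ _ := lintegral_mono' (P.comp_transition_le t) le_rfl

theorem ae_integrable_of_abs_rpow {f V : E → ℝ} {p q : ℝ} (hq : 0 ≤ q) (hqp : q ≤ p)
    (hV : Measurable V) (hVf : ∀ x, |V x| = |f x| ^ q)
    (hf : Integrable (fun x => |f x| ^ p) m) (t : ℝ≥0) :
    ∀ᵐ x ∂m, Integrable V (P.transition t x) := by
  filter_upwards [P.ae_integrable_transition hf t] with x hx using
    integrable_of_abs_rpow_le hq hqp hV.aestronglyMeasurable hVf hx

theorem op_add {f : E → ℝ} (hm : Measurable f) {s t : ℝ≥0}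
    (hf : ∀ᵐ x ∂m, Integrable f (P.transition (s + t) x)) :
    P.op (s + t) f =ᵐ[m] P.op s (P.op t f) := by
  have hk : ∀ x, P.transition (s + t) x = ((P.transition t) ∘ₖ (P.transition s)) x := by
    intro x
    ext B hB
    rw [Kernel.comp_apply' _ _ _ hB]
    exact P.chapman_kolmogorov s t x B hB
  filter_upwards [hf] with x hx
  rw [op_eq, hk, Kernel.integral_comp (by rwa [← hk])]
  rfl

theorem integrable_sq_op {w : E → ℝ} (hm : Measurable w) (hw : Integrable (fun x => w x ^ 2) m)
    (t : ℝ≥0) : Integrable (fun x => P.op t w x ^ 2) m ∧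
      ∫ x, P.op t w x ^ 2 ∂m ≤ ∫ x, w x ^ 2 ∂m := by
  have hw' : Integrable (fun x => |w x| ^ (2 : ℝ)) m := by simpa using hw
  have h1 := P.ae_integrable_of_abs_rpow (f := w) zero_le_one one_le_two hm (by simp) hw' t
  have hle : ∀ᵐ x ∂m, P.op t w x ^ 2 ≤ P.op t (fun z => w z ^ 2) x := by
    filter_upwards [h1, P.ae_integrable_transition hw t] with x hx hx2 using
      sq_integral_le_of_measure_le_one (P.le_one t x) hx hx2
  have hi := P.integrable_op (hm.pow_const 2) hw t
  have hint : Integrable (fun x => P.op t w x ^ 2) m :=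
    hi.mono' ((P.measurable_op hm t).pow_const 2).aestronglyMeasurable (by
      filter_upwards [hle] with x hx
      rwa [Real.norm_of_nonneg (sq_nonneg _)])
  exact ⟨hint, (integral_mono_ae hint hi hle).trans
    (P.integral_op_le (hm.pow_const 2) hw (fun x => sq_nonneg _) t)⟩

theorem integrable_mul_of_sq {f g : E → ℝ} (hf : Measurable f) (hg : Measurable g)
    (hf2 : Integrable (fun x => f x ^ 2) m) (hg2 : Integrable (fun x => g x ^ 2) m) :
    Integrable (fun x => f x * g x) m := by
  refine (hf2.add hg2).mono' (hf.mul hg).aestronglyMeasurable (ae_of_all _ fun x => ?_)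
  rw [Real.norm_eq_abs, abs_le]
  simp only [Pi.add_apply]
  constructor <;> nlinarith [sq_nonneg (f x + g x), sq_nonneg (f x - g x)]

theorem integral_mul_op_comm [SigmaFinite m] {f g : E → ℝ} (hf : Measurable f) (hg : Measurable g)
    (hf2 : Integrable (fun x => f x ^ 2) m) (hg2 : Integrable (fun x => g x ^ 2) m) (t : ℝ≥0) :
    ∫ x, f x * P.op t g x ∂m = ∫ x, g x * P.op t f x ∂m := by
  have hsq : ∀ h : E → ℝ, Measurable h → Integrable (fun x => h x ^ 2) m →
      Integrable (fun z : E × E => h z.2 ^ 2) (m ⊗ₘ P.transition t) := fun h hh hh2 =>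
    (Measure.integrable_compProd_snd_iff (f := fun x => h x ^ 2)
      (hh.pow_const 2).aestronglyMeasurable).2
      (hh2.mono_measure (P.comp_transition_le t))
  have hsq' : ∀ h : E → ℝ, Measurable h → Integrable (fun x => h x ^ 2) m →
      Integrable (fun z : E × E => h z.1 ^ 2) (m ⊗ₘ P.transition t) := fun h hh hh2 => by
    have := hsq h hh hh2
    rw [← P.map_swap_compProd t, integrable_map_measure
      (by exact (by fun_prop : Measurable fun z : E × E => h z.2 ^ 2).aestronglyMeasurable)
      measurable_swap.aemeasurable] at this
    exact this
  have hI : ∀ f g : E → ℝ, Measurable f → Measurable g → Integrable (fun x => f x ^ 2) m →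
      Integrable (fun x => g x ^ 2) m →
      Integrable (fun z : E × E => f z.1 * g z.2) (m ⊗ₘ P.transition t) := by
    intro f g hf hg hf2 hg2
    refine ((hsq' f hf hf2).add (hsq g hg hg2)).mono' (by fun_prop) (ae_of_all _ fun x => ?_)
    rw [Real.norm_eq_abs, abs_le]
    simp only [Pi.add_apply]
    constructor <;> nlinarith [sq_nonneg (f x.1 + g x.2), sq_nonneg (f x.1 - g x.2)]
  have hF : ∀ f g : E → ℝ, Measurable f → Measurable g → Integrable (fun x => f x ^ 2) m →
      Integrable (fun x => g x ^ 2) m →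
      ∫ x, f x * P.op t g x ∂m = ∫ z, f z.1 * g z.2 ∂(m ⊗ₘ P.transition t) := by
    intro f g hf hg hf2 hg2
    rw [Measure.integral_compProd (hI f g hf hg hf2 hg2)]
    simp only [integral_const_mul]
    rfl
  rw [hF f g hf hg hf2 hg2, hF g f hg hf hg2 hf2]
  nth_rewrite 1 [← P.map_swap_compProd t]
  rw [integral_map measurable_swap.aemeasurable (by fun_prop)]
  simp only [Prod.fst_swap, Prod.snd_swap, mul_comm]

/-- The squared `L²` norm `t ↦ ‖P_t w‖²`. -/
noncomputable def sqNorm (w : E → ℝ) (t : ℝ≥0) : ℝ := ∫ x, P.op t w x ^ 2 ∂m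

theorem sqNorm_zero {w : E → ℝ} (hm : Measurable w) : P.sqNorm w 0 = ∫ x, w x ^ 2 ∂m := by
  rw [sqNorm, P.op_zero hm]

theorem op_add_of_sq {w : E → ℝ} (hm : Measurable w)
    (hw : Integrable (fun x => w x ^ 2) m) (s t : ℝ≥0) : P.op (s + t) w =ᵐ[m] P.op s (P.op t w) :=
  P.op_add hm (P.ae_integrable_of_abs_rpow (f := w) (p := 2) zero_le_one one_le_two hm (by simp)
    (by simpa using hw) _)

theorem antitone_sqNorm {w : E → ℝ} (hm : Measurable w)
    (hw : Integrable (fun x => w x ^ 2) m) : Antitone (P.sqNorm w) := by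
  intro s t hst
  obtain ⟨r, rfl⟩ := exists_add_of_le hst
  have h := P.op_add_of_sq hm hw r s
  rw [add_comm] at h
  calc P.sqNorm w (s + r) = ∫ x, P.op r (P.op s w) x ^ 2 ∂m :=
        integral_congr_ae (by filter_upwards [h] with x hx; rw [hx])
    _ ≤ _ := (P.integrable_sq_op (P.measurable_op hm s) (P.integrable_sq_op hm hw s).1 r).2

theorem integral_op_mul_op [SigmaFinite m] {w : E → ℝ} (hm : Measurable w)
    (hw : Integrable (fun x => w x ^ 2) m) (s t : ℝ≥0) :
    ∫ x, P.op s w x * P.op t w x ∂m = ∫ x, w x * P.op (s + t) w x ∂m := by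
  have h2 := (P.integrable_sq_op hm hw t).1
  calc ∫ x, P.op s w x * P.op t w x ∂m = ∫ x, P.op t w x * P.op s w x ∂m := by
        simp only [mul_comm]
    _ = ∫ x, w x * P.op s (P.op t w) x ∂m :=
        P.integral_mul_op_comm (P.measurable_op hm t) hm h2 hw s
    _ = _ := integral_congr_ae (by
        filter_upwards [P.op_add_of_sq hm hw s t] with x hx; rw [hx])

theorem sqNorm_eq [SigmaFinite m] {w : E → ℝ} (hm : Measurable w)
    (hw : Integrable (fun x => w x ^ 2) m) (t : ℝ≥0) :
    P.sqNorm w t = ∫ x, w x * P.op (t + t) w x ∂m := by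
  rw [← P.integral_op_mul_op hm hw]
  simp only [sqNorm, pow_two]

/-- By symmetry `‖P_r w‖² = ⟨P_s w, P_t w⟩` whenever `2r = s + t`; the rest is `2ab ≤ a² + b²`. -/
theorem two_mul_sqNorm_le [SigmaFinite m] {w : E → ℝ} (hm : Measurable w)
    (hw : Integrable (fun x => w x ^ 2) m) {r s t : ℝ≥0} (h : r + r = s + t) :
    2 * P.sqNorm w r ≤ P.sqNorm w s + P.sqNorm w t := by
  have hs := (P.integrable_sq_op hm hw s).1
  have ht := (P.integrable_sq_op hm hw t).1
  have hst := integrable_mul_of_sq (P.measurable_op hm s) (P.measurable_op hm t) hs ht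
  rw [P.sqNorm_eq hm hw, h, ← P.integral_op_mul_op hm hw, ← integral_const_mul, sqNorm, sqNorm,
    ← integral_add hs ht]
  refine integral_mono (hst.const_mul 2) (hs.add ht) fun x => ?_
  nlinarith [sq_nonneg (P.op s w x - P.op t w x)]

theorem sqNorm_quotient_le [SigmaFinite m] {w : E → ℝ} (hm : Measurable w)
    (hw : Integrable (fun x => w x ^ 2) m) {s t : ℝ≥0} (hs : 0 < s) (hst : s ≤ t) :
    (P.sqNorm w 0 - P.sqNorm w t) / t ≤ (P.sqNorm w 0 - P.sqNorm w s) / s :=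
  (P.antitone_sqNorm hm hw).sub_div_le_of_midpoint
    (fun _ _ _ h => P.two_mul_sqNorm_le hm hw h) hs hst

/-- `⟨w, P_{2t} w⟩ = ‖P_t w‖²`, so the approximating form at time `2t` measures the `L²` decay at
time `t`. This doubling is the source of the factor `2` in `exists_mem_domain`. -/
theorem integral_sub_op_mul [SigmaFinite m] {w : E → ℝ} (hm : Measurable w)
    (hw : Integrable (fun x => w x ^ 2) m) (t : ℝ≥0) :
    ∫ x, (w x - P.op (t + t) w x) * w x ∂m = P.sqNorm w 0 - P.sqNorm w t := by
  have h1 := integrable_mul_of_sq hm (P.measurable_op hm (t + t)) hw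
    (P.integrable_sq_op hm hw (t + t)).1
  rw [P.sqNorm_zero hm, P.sqNorm_eq hm hw, ← integral_sub hw h1]
  congr 1
  ext x
  ring

/-- The quotients `(1/t) ∫ (w - P_t w) w dm` depend on the class of `w` only. -/
theorem integral_sub_op_mul_congr {w v : E → ℝ} (h : v =ᵐ[m] w) (t : ℝ≥0) :
    ∫ x, (v x - P.op t v x) * v x ∂m = ∫ x, (w x - P.op t w x) * w x ∂m := by
  refine integral_congr_ae ?_
  filter_upwards [h, P.op_congr h t] with x hx hx'
  rw [hx, hx']

/-! ### Membership in the form domain and continuity at time zero. -/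

section Associated

variable {P} {𝓔 : DirichletForm m}

/-- The approximating forms increase as `t` decreases to `0`. Once bounded they converge, which is
the criterion for the domain, and their limit dominates each of them. -/
theorem IsAssociated.exists_mem_domain [SigmaFinite m] (hP : P.IsAssociated 𝓔) {w : E → ℝ}
    (hm : Measurable w) (hw : Integrable (fun x => w x ^ 2) m) {K : ℝ}
    (hK : ∀ h : ℝ≥0, 0 < h → (P.sqNorm w 0 - P.sqNorm w h) / h ≤ K) :
    ∃ v : 𝓔.domain, ((v : Lp ℝ 2 m) : E → ℝ) =ᵐ[m] w ∧
      ∀ h : ℝ≥0, P.sqNorm w 0 - P.sqNorm w h ≤ 2 * h * 𝓔.form v v := by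
  have hmem : MemLp w 2 m := (memLp_two_iff_integrable_sq hm.aestronglyMeasurable).2 hw
  have hae := hmem.coeFn_toLp
  set e : ℝ≥0 → ℝ := fun t => (1 / (t : ℝ)) *
    ∫ x, ((hmem.toLp w) x - P.op t (hmem.toLp w) x) * (hmem.toLp w) x ∂m with he
  have hee : ∀ t : ℝ≥0, e t = (P.sqNorm w 0 - P.sqNorm w (t / 2)) / (t / 2 : ℝ≥0) / 2 := by
    intro t
    simp only [he]
    rw [P.integral_sub_op_mul_congr hae, ← P.integral_sub_op_mul hm hw, add_halves]
    rcases eq_or_ne t 0 with rfl | ht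
    · simp
    · have : (t : ℝ) ≠ 0 := by exact_mod_cast ht
      push_cast
      field_simp
  have hanti : AntitoneOn e (Set.Ioi 0) := by
    intro s hs t ht hst
    rw [hee, hee]
    have hs' : (0 : ℝ≥0) < s / 2 := half_pos hs
    have := P.sqNorm_quotient_le hm hw hs' (by gcongr : s / 2 ≤ t / 2)
    linarith
  have hbdd : BddAbove (e '' Set.Ioi 0) := by
    refine ⟨K / 2, ?_⟩
    rintro _ ⟨t, ht, rfl⟩
    rw [hee]
    have := hK (t / 2) (half_pos ht)
    linarith
  have hdom := (hP.mem_domain_iff (hmem.toLp w)).2 ⟨_, hanti.tendsto_nhdsGT hbdd⟩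
  refine ⟨⟨hmem.toLp w, hdom⟩, hae, fun h => ?_⟩
  rcases eq_or_ne h 0 with rfl | hh
  · simp
  have hh' : (0 : ℝ≥0) < 2 * h := by positivity
  have hlim := hP.form_eq ⟨hmem.toLp w, hdom⟩ ⟨hmem.toLp w, hdom⟩
  have hle : e (2 * h) ≤ 𝓔.form ⟨hmem.toLp w, hdom⟩ ⟨hmem.toLp w, hdom⟩ := by
    refine ge_of_tendsto hlim ?_
    filter_upwards [Ioo_mem_nhdsGT hh'] with t ht
    exact hanti ht.1 hh' ht.2.le
  rw [hee, mul_div_cancel_left₀ h two_ne_zero] at hle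
  have hpos : (0 : ℝ) < h := by exact_mod_cast hh.bot_lt
  rw [div_div, div_le_iff₀ (by positivity)] at hle
  linarith

/-- The decay at time `h` is `2h` times an approximating form with finite limit. -/
theorem IsAssociated.tendsto_sqNorm_of_mem [SigmaFinite m] (hP : P.IsAssociated 𝓔) {w : E → ℝ}
    (hm : Measurable w) (hw : Integrable (fun x => w x ^ 2) m) (v : 𝓔.domain)
    (hv : ((v : Lp ℝ 2 m) : E → ℝ) =ᵐ[m] w) :
    Tendsto (fun h => P.sqNorm w 0 - P.sqNorm w h) (𝓝[>] 0) (𝓝 0) := by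
  have hlim := hP.form_eq v v
  have hid : Tendsto (fun t : ℝ≥0 => (t : ℝ)) (𝓝[>] 0) (𝓝 0) := by
    have : Tendsto (fun t : ℝ≥0 => (t : ℝ)) (𝓝 0) (𝓝 ((0 : ℝ≥0) : ℝ)) :=
      NNReal.continuous_coe.tendsto 0
    exact this.mono_left nhdsWithin_le_nhds
  have h1 := hid.mul hlim
  rw [zero_mul] at h1
  have h2 : Tendsto (fun h : ℝ≥0 => h + h) (𝓝[>] 0) (𝓝[>] 0) := by
    refine tendsto_nhdsWithin_iff.2 ⟨?_, ?_⟩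
    · have : Tendsto (fun h : ℝ≥0 => h + h) (𝓝 0) (𝓝 (0 + 0)) :=
        (continuous_id.add continuous_id).tendsto 0
      rw [add_zero] at this
      exact this.mono_left nhdsWithin_le_nhds
    · filter_upwards [self_mem_nhdsWithin] with h hh
      exact add_pos (Set.mem_Ioi.1 hh) (Set.mem_Ioi.1 hh)
  refine (h1.comp h2).congr' ?_
  filter_upwards [self_mem_nhdsWithin] with h hh
  have hpos : (0 : ℝ) < h := hh
  simp only [Function.comp]
  rw [P.integral_sub_op_mul_congr hv, P.integral_sub_op_mul hm hw]
  push_cast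
  field_simp

/-- `P_t` is strongly continuous at `0` on `L²`, in the form `‖P_t w‖ → ‖w‖`. -/
theorem IsAssociated.tendsto_sqNorm [SigmaFinite m] (hP : P.IsAssociated 𝓔) {w : E → ℝ}
    (hm : Measurable w) (hw : Integrable (fun x => w x ^ 2) m) :
    Tendsto (fun h => P.sqNorm w 0 - P.sqNorm w h) (𝓝[>] 0) (𝓝 0) := by
  have hmem : MemLp w 2 m := (memLp_two_iff_integrable_sq hm.aestronglyMeasurable).2 hw
  refine tendsto_order.2 ⟨fun a ha => Eventually.of_forall fun h =>
    ha.trans_le (sub_nonneg.2 (P.antitone_sqNorm hm hw zero_le)), fun ε hε => ?_⟩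
  obtain ⟨v, hvd, hv⟩ := 𝓔.dense.exists_dist_lt (hmem.toLp w)
    (ε := Real.sqrt (ε / 4)) (Real.sqrt_pos.2 (by linarith))
  set u : E → ℝ := (v : E → ℝ) with hu
  have hum : Measurable u := (Lp.stronglyMeasurable v).measurable
  have hu2 : Integrable (fun x => u x ^ 2) m := (Lp.memLp v).integrable_sq
  set d : E → ℝ := fun x => w x - u x with hd
  have hdm : Measurable d := hm.sub hum
  have hd2 : Integrable (fun x => d x ^ 2) m := (hmem.sub (Lp.memLp v)).integrable_sq
  have hdist : ∫ x, d x ^ 2 ∂m < ε / 4 := by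
    rw [dist_eq_norm] at hv
    have h1 : ‖hmem.toLp w - v‖ ^ 2 < ε / 4 := by
      rw [← Real.sq_sqrt (by linarith : 0 ≤ ε / 4)]
      gcongr
    have h2 : ‖hmem.toLp w - v‖ ^ 2 = ∫ x, d x ^ 2 ∂m := by
      rw [← real_inner_self_eq_norm_sq, L2.inner_def]
      refine integral_congr_ae ?_
      filter_upwards [Lp.coeFn_sub (hmem.toLp w) v, hmem.coeFn_toLp] with x h3 h4
      simp only [h3, Pi.sub_apply, h4, hd, hu]
      simp [pow_two]
    rwa [h2] at h1
  have hlim := hP.tendsto_sqNorm_of_mem hum hu2 ⟨v, hvd⟩ (ae_eq_refl _)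
  filter_upwards [hlim.eventually_lt_const (by linarith : (0 : ℝ) < ε / 4)] with h hh
  -- The decay `‖·‖² - ‖P_h ·‖²` is a non-negative quadratic form, so the parallelogram law for `w =
  -- u + d` and `g = u - d` bounds it at `w` by twice its values at `u` and `d`, each below `ε/4`.
  set g : E → ℝ := fun x => u x - d x with hg
  have hgm : Measurable g := hum.sub hdm
  have hg2 : Integrable (fun x => g x ^ 2) m :=
    ((Lp.memLp v).sub (hmem.sub (Lp.memLp v))).integrable_sq
  have hint : ∀ f : E → ℝ, Measurable f → Integrable (fun x => f x ^ 2) m →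
      ∀ᵐ x ∂m, Integrable f (P.transition h x) := fun f hf hf2 =>
    P.ae_integrable_of_abs_rpow (f := f) (p := 2) zero_le_one one_le_two hf (by simp)
      (by simpa using hf2) _
  have hpar : ∀ {a b c e : E → ℝ}, Integrable (fun x => a x ^ 2) m →
      Integrable (fun x => b x ^ 2) m → Integrable (fun x => c x ^ 2) m →
      Integrable (fun x => e x ^ 2) m → (∀ᵐ x ∂m, a x = c x + e x ∧ b x = c x - e x) →
      ∫ x, a x ^ 2 ∂m + ∫ x, b x ^ 2 ∂m = 2 * ∫ x, c x ^ 2 ∂m + 2 * ∫ x, e x ^ 2 ∂m := by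
    intro a b c e ha hb hc he h
    rw [← integral_add ha hb, ← mul_add, ← integral_add hc he, ← integral_const_mul]
    refine integral_congr_ae ?_
    filter_upwards [h] with x hx
    rw [hx.1, hx.2]
    ring
  have e0 := hpar hw hg2 hu2 hd2 (ae_of_all _ fun x => ⟨by simp only [hd]; ring, rfl⟩)
  have e1 := hpar (P.integrable_sq_op hm hw h).1 (P.integrable_sq_op hgm hg2 h).1
    (P.integrable_sq_op hum hu2 h).1 (P.integrable_sq_op hdm hd2 h).1 (by
      filter_upwards [hint u hum hu2, hint d hdm hd2] with x h1 h2
      refine ⟨?_, integral_sub h1 h2⟩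
      rw [op_eq, op_eq, op_eq, ← integral_add h1 h2]
      simp [hd])
  have e2 := (P.integrable_sq_op hgm hg2 h).2
  have e3 : 0 ≤ ∫ x, P.op h d x ^ 2 ∂m := integral_nonneg fun x => sq_nonneg _
  rw [P.sqNorm_zero hum, sqNorm] at hh
  rw [P.sqNorm_zero hm, sqNorm]
  linarith

end Associated

/-- The decay of `∫ |P_h f|^p dm` is comparable with that of `‖P_h (f^{⟨p/2⟩})‖²`. -/
theorem integral_abs_rpow_op {f : E → ℝ} {p : ℝ} (hp : 3 ≤ p) (hm : Measurable f)
    (hf : Integrable (fun x => |f x| ^ p) m) (h : ℝ≥0) :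
    Integrable (fun x => |P.op h f x| ^ p) m ∧
    ∫ x, |P.op h f x| ^ p ∂m ≤ ∫ x, |f x| ^ p ∂m ∧
    ∫ x, |f x| ^ p ∂m - ∫ x, |P.op h f x| ^ p ∂m
      ≤ 2 * p * (P.sqNorm (fun x => signedPow (p / 2) (f x)) 0
          - P.sqNorm (fun x => signedPow (p / 2) (f x)) h) ∧
    P.sqNorm (fun x => signedPow (p / 2) (f x)) 0 - P.sqNorm (fun x => signedPow (p / 2) (f x)) h
      ≤ 2 * (∫ x, |f x| ^ p ∂m - ∫ x, |P.op h f x| ^ p ∂m) := by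
  set w : E → ℝ := fun x => signedPow (p / 2) (f x) with hw
  have hwm : Measurable w := (measurable_signedPow _).comp hm
  have hw2 : Integrable (fun x => w x ^ 2) m := by simpa only [hw, signedPow_half_sq] using hf
  have hfm : Measurable fun x => |f x| ^ p := by fun_prop
  have hif := P.integrable_op hfm hf h
  have hle := P.integral_op_le hfm hf (fun x => Real.rpow_nonneg (abs_nonneg _) _) h
  have hgap : ∀ᵐ x ∂m,
      (P.op h (fun z => |f z| ^ p) x - |P.op h f x| ^ p
        ≤ 2 * p * (P.op h (fun z => |f z| ^ p) x - P.op h w x ^ 2)) ∧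
      (P.op h (fun z => |f z| ^ p) x - P.op h w x ^ 2
        ≤ 2 * (P.op h (fun z => |f z| ^ p) x - |P.op h f x| ^ p)) ∧
      P.op h w x ^ 2 ≤ P.op h (fun z => |f z| ^ p) x := by
    filter_upwards [P.ae_integrable_transition hf h, P.ae_integrable_transition hw2 h,
      P.ae_integrable_of_abs_rpow (by linarith : 0 ≤ p / 2) (by linarith) hwm
      (fun x => abs_signedPow (p / 2) (f x)) hf h] with x hx hx2 hx3
    obtain ⟨h1, h2⟩ := jensenGap_le_variance hp (P.le_one h x) hm.aestronglyMeasurable hx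
    refine ⟨h1, h2, ?_⟩
    have := sq_integral_le_of_measure_le_one (P.le_one h x) hx3 hx2
    simp only [hw, signedPow_half_sq] at this
    exact this
  have hint : Integrable (fun x => |P.op h f x| ^ p) m := by
    refine hif.mono' ((P.measurable_op hm h).abs.pow_const p).aestronglyMeasurable ?_
    filter_upwards [hgap] with x hx
    rw [Real.norm_of_nonneg (Real.rpow_nonneg (abs_nonneg _) _)]
    linarith [hx.2.1, hx.2.2]
  have hwi := (P.integrable_sq_op hwm hw2 h).1
  have hS0 : P.sqNorm w 0 = ∫ x, |f x| ^ p ∂m := by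
    rw [P.sqNorm_zero hwm]
    simp only [hw, signedPow_half_sq]
  have hA := integral_mono_ae (hif.sub hint) ((hif.sub hwi).const_mul (2 * p))
    (hgap.mono fun x hx => by simpa using hx.1)
  have hB := integral_mono_ae (hif.sub hwi) ((hif.sub hint).const_mul 2)
    (hgap.mono fun x hx => by simpa using hx.2.1)
  have hC := integral_mono_ae hint hif (hgap.mono fun x hx => by
    show |P.op h f x| ^ p ≤ _
    linarith [hx.2.1, hx.2.2])
  rw [integral_const_mul, integral_sub' hif hint, integral_sub' hif hwi] at hA hB
  rw [hS0, sqNorm]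
  refine ⟨hint, hC.trans hle, ?_, ?_⟩
  -- The loss `∫ |f|^p - ∫ P_h |f|^p` belongs to both decays and is added to the integrated gaps;
  -- `2p ≥ 1` absorbs it.
  · nlinarith [mul_nonneg (by linarith : 0 ≤ 2 * p - 1) (sub_nonneg.2 hle)]
  · linarith

end SymmTransitionFunction

/-! ### The jumping kernel off the diagonal. -/

/-- The total mass need not be bounded uniformly; cutting the space by its integer part gives
countably many finite kernels. -/
theorem ProbabilityTheory.Kernel.isSFiniteKernel_of_lt_top {α β : Type*} [MeasurableSpace α]
    [MeasurableSpace β] (κ : Kernel α β) (h : ∀ x, κ x Set.univ < ∞) : IsSFiniteKernel κ := by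
  classical
  set c : α → ℕ := fun x => ⌊(κ x Set.univ).toReal⌋₊ with hc
  have hcm : Measurable c :=
    Nat.measurable_floor.comp (κ.measurable_coe MeasurableSet.univ).ennreal_toReal
  have hs : ∀ n : ℕ, MeasurableSet (c ⁻¹' {n}) := fun n => hcm (measurableSet_singleton n)
  have hfin : ∀ n : ℕ, IsFiniteKernel (Kernel.piecewise (hs n) κ 0) := fun n => by
    refine ⟨(n : ℝ≥0∞) + 1, by finiteness, fun x => ?_⟩
    rw [Kernel.piecewise_apply]
    split_ifs with hx
    · have h1 : (κ x Set.univ).toReal < n + 1 := by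
        have := Nat.lt_floor_add_one (κ x Set.univ).toReal
        have hx' : c x = n := hx
        rw [← hx']
        exact this
      rw [← ENNReal.ofReal_toReal (h x).ne]
      refine (ENNReal.ofReal_le_ofReal h1.le).trans ?_
      rw [ENNReal.ofReal_add (by positivity) zero_le_one]
      simp
    · simp
  have hsum : κ = Kernel.sum fun n => Kernel.piecewise (hs n) κ 0 := by
    ext x B hB
    rw [Kernel.sum_apply' _ _ hB, tsum_eq_single (c x)]
    · rw [Kernel.piecewise_apply, if_pos (show x ∈ c ⁻¹' {c x} from rfl)]
    · intro n hn
      rw [Kernel.piecewise_apply, if_neg (by simpa using hn.symm)]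
      simp
  rw [hsum]
  infer_instance

/-- A kernel which is finite on the slices of countably many measurable rectangles covering the
complement of the diagonal becomes s-finite after removal of the diagonal. -/
theorem exists_isSFiniteKernel_restrict_compl {E : Type*} [MeasurableSpace E]
    [MeasurableSingletonClass E] {J : Kernel E E} {N : Set E}
    (hN : MeasurableSet N) {K L : ℕ → Set E} (hK : ∀ n, MeasurableSet (K n))
    (hL : ∀ n, MeasurableSet (L n)) (hfin : ∀ n, ∀ x ∈ K n, x ∉ N → J x (L n) < ∞)
    (hcover : ⋃ n, K n ×ˢ L n = {z : E × E | z.1 ≠ z.2}) :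
    ∃ J' : Kernel E E, IsSFiniteKernel J' ∧ (∀ x ∈ N, J' x = 0) ∧
      ∀ x, x ∉ N → J' x = (J x).restrict {x}ᶜ := by
  classical
  -- The rectangles are made disjoint so that the sum of the pieces counts each off-diagonal pair
  -- once.
  set R : ℕ → Set (E × E) := fun n => K n ×ˢ L n with hR
  have hRm : ∀ n, MeasurableSet (disjointed R n) :=
    fun n => MeasurableSet.disjointed (fun n => (hK n).prod (hL n)) n
  set J₁ : ℕ → Kernel E E := fun n =>
    Kernel.piecewise ((hK n).diff hN) (J.restrict (hL n)) 0 with hJ₁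
  have hJ₁fin : ∀ n, IsSFiniteKernel (J₁ n) := fun n => by
    refine Kernel.isSFiniteKernel_of_lt_top _ fun x => ?_
    simp only [hJ₁, Kernel.piecewise_apply]
    split_ifs with hx
    · rw [Kernel.restrict_apply, Measure.restrict_apply_univ]
      exact hfin n x hx.1 hx.2
    · simp
  have hdm : ∀ n, Measurable (Function.uncurry fun x y : E =>
      (disjointed R n).indicator (fun _ => (1 : ℝ≥0∞)) (x, y)) := fun n =>
    measurable_const.indicator (hRm n)
  set J₂ : ℕ → Kernel E E := fun n => Kernel.withDensity (J₁ n)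
    (fun x y => (disjointed R n).indicator (fun _ => (1 : ℝ≥0∞)) (x, y)) with hJ₂
  have hJ₂fin : ∀ n, IsSFiniteKernel (J₂ n) := fun n =>
    Kernel.IsSFiniteKernel.withDensity _ fun x y => by
      by_cases h : (x, y) ∈ disjointed R n <;> simp [h]
  have hsec : ∀ n x, MeasurableSet {y | (x, y) ∈ disjointed R n} := fun n x =>
    measurable_prodMk_left (hRm n)
  have hJ₂app : ∀ n x B, MeasurableSet B →
      J₂ n x B = J₁ n x ({y | (x, y) ∈ disjointed R n} ∩ B) := by
    intro n x B hB
    have e : (fun y => (disjointed R n).indicator (fun _ => (1 : ℝ≥0∞)) (x, y))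
        = {y | (x, y) ∈ disjointed R n}.indicator 1 := by
      ext y
      simp [Set.indicator]
    rw [hJ₂, Kernel.withDensity_apply' _ (hdm n), e, lintegral_indicator_one (hsec n x),
      Measure.restrict_apply (hsec n x)]
  refine ⟨Kernel.sum J₂, inferInstance, fun x hx => ?_, fun x hx => ?_⟩
  · ext B hB
    rw [Kernel.sum_apply' _ _ hB]
    simp only [hJ₂app _ _ _ hB, hJ₁, Kernel.piecewise_apply, Set.mem_sdiff, hx, not_true, and_false,
      if_false]
    simp
  · ext B hB
    rw [Kernel.sum_apply' _ _ hB, Measure.restrict_apply hB]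
    have e : B ∩ {x}ᶜ = ⋃ n, {y | (x, y) ∈ disjointed R n} ∩ B := by
      ext y
      have hy : (x, y) ∈ ⋃ n, R n ↔ (x, y) ∈ {z : E × E | z.1 ≠ z.2} := by rw [hR, hcover]
      rw [← iUnion_disjointed] at hy
      simp only [Set.mem_iUnion, Set.mem_ofPred_eq] at hy
      simp only [Set.mem_inter_iff, Set.mem_compl_iff, Set.mem_singleton_iff, Set.mem_iUnion,
        Set.mem_ofPred_eq, exists_and_right, hy, ne_comm (a := x)]
      tauto
    rw [e, measure_iUnion]
    · refine tsum_congr fun n => ?_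
      rw [hJ₂app _ _ _ hB]
      simp only [hJ₁, Kernel.piecewise_apply, Set.mem_sdiff, hx, not_false_iff, and_true]
      have hsub := disjointed_subset R n
      split_ifs with hxK
      · rw [Kernel.restrict_apply, Measure.restrict_apply ((hsec n x).inter hB)]
        congr 1
        ext y
        simp only [Set.mem_inter_iff, Set.mem_ofPred_eq, and_iff_left_iff_imp]
        exact fun h => (hsub h.1).2
      · have : {y | (x, y) ∈ disjointed R n} ∩ B = ∅ := by
          ext y
          simp only [Set.mem_inter_iff, Set.mem_ofPred_eq, Set.mem_empty_iff_false, iff_false]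
          exact fun h => hxK (hsub h.1).1
        simp [this]
    · intro i j hij
      refine Set.disjoint_left.2 fun y h1 h2 => ?_
      exact Set.disjoint_left.1 (disjoint_disjointed R hij) h1.1 h2.1
    · exact fun n => (hsec n x).inter hB

/-- Distinct points have disjoint compact neighbourhoods, and the Lindelöf property leaves countably
many of their products. -/
theorem exists_compact_rectangles_cover_compl_diagonal (E : Type*) [TopologicalSpace E] [T2Space E]
    [LocallyCompactSpace E] [SecondCountableTopology E] :
    ∃ K L : ℕ → Set E, (∀ n, IsCompact (K n)) ∧ (∀ n, IsCompact (L n)) ∧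
      (∀ n, Disjoint (K n) (L n)) ∧ ⋃ n, K n ×ˢ L n = {z : E × E | z.1 ≠ z.2} := by
  have h : ∀ z : E × E, ∃ K L : Set E, IsCompact K ∧ IsCompact L ∧ Disjoint K L ∧
      (z.1 ≠ z.2 → K ×ˢ L ∈ 𝓝 z) := by
    intro z
    by_cases hz : z.1 = z.2
    · exact ⟨∅, ∅, isCompact_empty, isCompact_empty, disjoint_bot_left, fun h => absurd hz h⟩
    · obtain ⟨U, V, hU, hV, hzU, hzV, hUV⟩ := t2_separation hz
      obtain ⟨K, hK, hKU, hKc⟩ := local_compact_nhds (hU.mem_nhds hzU)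
      obtain ⟨L, hL, hLV, hLc⟩ := local_compact_nhds (hV.mem_nhds hzV)
      exact ⟨K, L, hKc, hLc, hUV.mono hKU hLV, fun _ => prod_mem_nhds hK hL⟩
  choose K L hK hL hd hn using h
  obtain ⟨t, hts, htc, hcov⟩ := TopologicalSpace.countable_cover_nhdsWithin
    (s := {z : E × E | z.1 ≠ z.2}) (f := fun z => K z ×ˢ L z)
    (fun z hz => mem_nhdsWithin_of_mem_nhds (hn z hz))
  have hsub : ∀ z, K z ×ˢ L z ⊆ {z : E × E | z.1 ≠ z.2} := fun z y hy heq =>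
    Set.disjoint_left.1 (hd z) hy.1 (heq ▸ hy.2)
  rcases t.eq_empty_or_nonempty with rfl | hne
  · refine ⟨fun _ => ∅, fun _ => ∅, fun _ => isCompact_empty, fun _ => isCompact_empty,
      fun _ => disjoint_bot_left, ?_⟩
    simpa using (Set.subset_empty_iff.1 (by simpa using hcov)).symm
  · obtain ⟨z, rfl⟩ := htc.exists_eq_range hne
    refine ⟨fun n => K (z n), fun n => L (z n), fun n => hK _, fun n => hL _, fun n => hd _,
      Set.Subset.antisymm (Set.iUnion_subset fun n => hsub _) ?_⟩
    simpa using hcov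

/-- A jumping kernel restricted to the complement of the diagonal agrees, off a null set, with an
s-finite kernel whose product with `m` is symmetric. -/
theorem DirichletForm.IsPureJump.exists_offDiagonal_kernel {E : Type*} [TopologicalSpace E]
    [T2Space E] [LocallyCompactSpace E] [SecondCountableTopology E] [MeasurableSpace E]
    [BorelSpace E] {m : Measure E} [SigmaFinite m] {𝓔 : DirichletForm m} {J : Kernel E E}
    (hJ : 𝓔.IsPureJump J) :
    ∃ J' : Kernel E E, IsSFiniteKernel J' ∧ (∀ x, J' x ≤ (J x).restrict {x}ᶜ) ∧
      (∀ᵐ x ∂m, J' x = (J x).restrict {x}ᶜ) ∧ (m ⊗ₘ J').map Prod.swap = m ⊗ₘ J' := by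
  obtain ⟨K, L, hK, hL, hd, hcov⟩ := exists_compact_rectangles_cover_compl_diagonal E
  have hKm := fun n => (hK n).measurableSet
  have hLm := fun n => (hL n).measurableSet
  -- The Radon condition makes `N` null. On it the kernel is replaced by `0`, which keeps the
  -- domination by `J` valid at every point.
  set N : Set E := ⋃ n, {x | x ∈ K n ∧ J x (L n) = ∞} with hNdef
  have hNm : MeasurableSet N := MeasurableSet.iUnion fun n =>
    (hKm n).inter (J.measurable_coe (hLm n) (measurableSet_singleton ∞))
  have hN0 : ∀ᵐ x ∂m, x ∉ N := by
    have : ∀ n, ∀ᵐ x ∂m, ¬ (x ∈ K n ∧ J x (L n) = ∞) := fun n => by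
      have h := ae_lt_top (J.measurable_coe (hLm n)) (hJ.radon _ _ (hK n) (hL n) (hd n)).ne
      rw [ae_restrict_iff' (hKm n)] at h
      filter_upwards [h] with x hx hx'
      exact (hx hx'.1).ne hx'.2
    filter_upwards [ae_all_iff.2 this] with x hx
    simpa [hNdef] using hx
  obtain ⟨J', hJ's, hJ'N, hJ'⟩ := exists_isSFiniteKernel_restrict_compl (J := J) hNm hKm hLm
    (fun n x hx hxN => lt_top_iff_ne_top.2 fun h => hxN (Set.mem_iUnion.2 ⟨n, hx, h⟩)) hcov
  have hae : ∀ᵐ x ∂m, J' x = (J x).restrict {x}ᶜ := hN0.mono hJ'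
  refine ⟨J', hJ's, fun x => ?_, hae, ?_⟩
  · by_cases hx : x ∈ N
    · rw [hJ'N x hx]
      exact Measure.zero_le _
    · exact (hJ' x hx).le
  have hrect : ∀ s t : Set E, MeasurableSet s → MeasurableSet t → Disjoint s t →
      (m ⊗ₘ J') (s ×ˢ t) = ∫⁻ x in s, J x t ∂m := by
    intro s t hs ht hst
    rw [Measure.compProd_apply_prod hs ht]
    refine setLIntegral_congr_fun_ae hs ?_
    filter_upwards [hae] with x hx hxs
    rw [hx, Measure.restrict_apply ht]
    congr 1
    refine Set.inter_eq_left.2 fun y hy => ?_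
    rintro rfl
    exact Set.disjoint_left.1 hst hxs hy
  have hcompl : (⋃ n, K n ×ˢ L n)ᶜ = {z : E × E | z.1 = z.2} := by
    rw [hcov]; ext z; simp
  have hdm : MeasurableSet {z : E × E | z.1 = z.2} := by
    rw [← hcompl]
    exact (MeasurableSet.iUnion fun n => (hKm n).prod (hLm n)).compl
  have hdiag : (m ⊗ₘ J') {z : E × E | z.1 = z.2} = 0 := by
    rw [Measure.compProd_apply hdm]
    refine (lintegral_congr_ae ?_).trans lintegral_zero
    filter_upwards [hae] with x hx
    have e : Prod.mk x ⁻¹' {z : E × E | z.1 = z.2} = {x} := by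
      ext y; simp [eq_comm]
    rw [e, hx, Measure.restrict_apply (measurableSet_singleton x)]
    simp
  symm
  refine Measure.ext_of_rectangles hKm hLm (fun n => ?_) (fun n s t hs ht hsK htL => ?_) ?_ ?_
  · rw [hrect _ _ (hKm n) (hLm n) (hd n)]
    exact (hJ.radon _ _ (hK n) (hL n) (hd n)).ne
  · have hst : Disjoint s t := (hd n).mono hsK htL
    rw [Measure.map_apply measurable_swap (hs.prod ht), Set.preimage_swap_prod,
      hrect _ _ hs ht hst, hrect _ _ ht hs hst.symm]
    exact hJ.symm _ _ hs ht hst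
  · rw [hcompl, hdiag]
  · rw [hcompl, Measure.map_apply measurable_swap hdm]
    have : Prod.swap ⁻¹' {z : E × E | z.1 = z.2} = {z : E × E | z.1 = z.2} := by
      ext z; simp [eq_comm]
    rw [this, hdiag]

/-! ### Splitting the weight `max(|a|, |b|)^{p-2}` by `χ`. -/

theorem chi_nonneg (s t : ℝ) : 0 ≤ chi s t := by
  unfold chi; split_ifs <;> norm_num

theorem chi_le_one (s t : ℝ) : chi s t ≤ 1 := by
  unfold chi; split_ifs <;> norm_num

theorem measurable_chi : Measurable fun z : ℝ × ℝ => chi z.1 z.2 := by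
  unfold chi
  refine Measurable.ite (measurableSet_lt (by fun_prop) (by fun_prop)) measurable_const
    (Measurable.ite (measurableSet_eq_fun (by fun_prop) (by fun_prop)) measurable_const
      measurable_const)

/-- `χ` assigns the weight to the endpoint of larger modulus, and its value `1/2` on ties makes the
splitting exact. -/
theorem mul_max_rpow_eq_chi (q a b : ℝ) :
    (a - b) ^ 2 * max |a| |b| ^ q
      = (b - a) ^ 2 * chi a b * |a| ^ q + (a - b) ^ 2 * chi b a * |b| ^ q := by
  unfold chi
  rcases lt_trichotomy |a| |b| with h | h | h
  · rw [if_neg h.not_gt, if_neg h.ne, if_pos h, max_eq_right h.le]; ring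
  · rw [if_neg h.not_gt, if_pos h, if_neg h.not_lt, if_pos h.symm, h, max_self]; ring
  · rw [if_pos h, if_neg h.not_gt, if_neg h.ne, max_eq_left h.le]; ring

/-- The integrand of `Γ̃[u]`. -/
noncomputable def tildeDensity (a b : ℝ) : ℝ≥0∞ := ENNReal.ofReal ((b - a) ^ 2 * chi a b)

theorem Measurable.tildeDensity {α : Type*} [MeasurableSpace α] {a b : α → ℝ}
    (ha : Measurable a) (hb : Measurable b) : Measurable fun x => tildeDensity (a x) (b x) :=
  (((hb.sub ha).pow_const 2).mul (measurable_chi.comp (ha.prodMk hb))).ennreal_ofReal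

theorem ofReal_signedPow_sub_sq_le {p : ℝ} (hp : 3 ≤ p) (a b : ℝ) :
    ENNReal.ofReal ((signedPow (p / 2) b - signedPow (p / 2) a) ^ 2)
      ≤ ENNReal.ofReal (p ^ 2) *
        (‖a‖ₑ ^ (p - 2) * tildeDensity a b + ‖b‖ₑ ^ (p - 2) * tildeDensity b a) := by
  have hq : 0 ≤ p - 2 := by linarith
  have e : ∀ c d : ℝ, ‖c‖ₑ ^ (p - 2) * tildeDensity c d
      = ENNReal.ofReal ((d - c) ^ 2 * chi c d * |c| ^ (p - 2)) := fun c d => by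
    rw [tildeDensity, ← ofReal_norm, Real.norm_eq_abs,
      ENNReal.ofReal_rpow_of_nonneg (abs_nonneg c) hq,
      ← ENNReal.ofReal_mul (by positivity), mul_comm]
  have hn : ∀ c d : ℝ, 0 ≤ (d - c) ^ 2 * chi c d * |c| ^ (p - 2) := fun c d =>
    mul_nonneg (mul_nonneg (sq_nonneg _) (chi_nonneg _ _)) (by positivity)
  rw [e, e, ← ENNReal.ofReal_add (hn a b) (hn b a), ← mul_max_rpow_eq_chi,
    ← ENNReal.ofReal_mul (by positivity)]
  refine ENNReal.ofReal_le_ofReal ?_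
  rw [show (signedPow (p / 2) b - signedPow (p / 2) a) ^ 2
    = (signedPow (p / 2) a - signedPow (p / 2) b) ^ 2 by ring]
  exact signedPow_half_sub_sq_le hp a b

/-- Off-diagonal energy of a signed power, by symmetrization of the weight `max^{p-2}`. -/
theorem lintegral_signedPow_sub_sq_le {E : Type*} [MeasurableSpace E] {ν : Measure (E × E)}
    (hν : ν.map Prod.swap = ν) {p : ℝ} (hp : 3 ≤ p) {u : E → ℝ} (hu : Measurable u) :
    ∫⁻ z, ENNReal.ofReal ((signedPow (p / 2) (u z.2) - signedPow (p / 2) (u z.1)) ^ 2) ∂ν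
      ≤ ENNReal.ofReal (2 * p ^ 2) *
        ∫⁻ z, ‖u z.1‖ₑ ^ (p - 2) * tildeDensity (u z.1) (u z.2) ∂ν := by
  have h1 : Measurable fun z : E × E => u z.1 := hu.comp measurable_fst
  have h2 : Measurable fun z : E × E => u z.2 := hu.comp measurable_snd
  have hG : Measurable fun z : E × E => ‖u z.1‖ₑ ^ (p - 2) * tildeDensity (u z.1) (u z.2) :=
    (h1.enorm.pow_const _).mul (h1.tildeDensity h2)
  have hG' : Measurable fun z : E × E => ‖u z.2‖ₑ ^ (p - 2) * tildeDensity (u z.2) (u z.1) :=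
    (h2.enorm.pow_const _).mul (h2.tildeDensity h1)
  have hswap : ∫⁻ z, ‖u z.2‖ₑ ^ (p - 2) * tildeDensity (u z.2) (u z.1) ∂ν
      = ∫⁻ z, ‖u z.1‖ₑ ^ (p - 2) * tildeDensity (u z.1) (u z.2) ∂ν := by
    nth_rewrite 1 [← hν]
    rw [lintegral_map hG' measurable_swap]
    rfl
  calc _ ≤ ∫⁻ z, ENNReal.ofReal (p ^ 2) *
        (‖u z.1‖ₑ ^ (p - 2) * tildeDensity (u z.1) (u z.2)
          + ‖u z.2‖ₑ ^ (p - 2) * tildeDensity (u z.2) (u z.1)) ∂ν :=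
        lintegral_mono fun z => ofReal_signedPow_sub_sq_le hp _ _
    _ = _ := by
        rw [lintegral_const_mul' _ _ ENNReal.ofReal_ne_top, lintegral_add_left hG, hswap,
          ← two_mul, ← mul_assoc, ENNReal.ofReal_mul zero_le_two, ENNReal.ofReal_ofNat,
          mul_comm (2 : ℝ≥0∞)]

/-! ### From increments to total decay. -/

/-- A decreasing function whose increments are controlled by `Q` has total decay at most `∫ Q`. -/
theorem ofReal_sub_le_lintegral_of_increment_le {ψ : ℝ → ℝ} (hψ : Antitone ψ) {Q : ℝ → ℝ≥0∞}
    (hQ : ∀ᵐ s ∂(volume.restrict (Set.Ioi (0 : ℝ))), ∀ h : ℝ, 0 < h →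
      ENNReal.ofReal (ψ s - ψ (s + h)) ≤ ENNReal.ofReal h * Q s)
    {h T : ℝ} (hh : 0 < h) (hT : 0 < T) :
    ENNReal.ofReal (ψ h - ψ T) ≤ ∫⁻ s in Set.Ioi (0 : ℝ), Q s := by
  have hi : ∀ a b : ℝ, IntervalIntegrable ψ volume a b := fun a b => hψ.intervalIntegrable
  have hanti : Antitone fun s => ψ (s + h) := fun a b hab => hψ (by linarith)
  have hi' : IntervalIntegrable (fun s => ψ (s + h)) volume 0 T := hanti.intervalIntegrable
  -- The integral of the increments telescopes to `∫_0^h ψ - ∫_T^{T+h} ψ`, and monotonicity bounds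
  -- each of these two integrals.
  have key : h * (ψ h - ψ T) ≤ ∫ s in (0 : ℝ)..T, (ψ s - ψ (s + h)) := by
    rw [intervalIntegral.integral_sub (hi _ _) hi', intervalIntegral.integral_comp_add_right ψ h,
      zero_add]
    have e1 := intervalIntegral.integral_add_adjacent_intervals (hi 0 h) (hi h (T + h))
    have e2 := intervalIntegral.integral_add_adjacent_intervals (hi 0 T) (hi T (T + h))
    have l1 : h * ψ h ≤ ∫ s in (0 : ℝ)..h, ψ s := by
      have := intervalIntegral.integral_mono_on hh.le (f := fun _ => ψ h)
        intervalIntegrable_const (hi 0 h) (fun s hs => hψ hs.2)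
      simpa using this
    have l2 : ∫ s in T..(T + h), ψ s ≤ h * ψ T := by
      have := intervalIntegral.integral_mono_on (by linarith : T ≤ T + h) (hi T (T + h))
        (g := fun _ => ψ T) intervalIntegrable_const (fun s hs => hψ hs.1)
      simpa using this
    linarith
  have hle : ENNReal.ofReal (∫ s in (0 : ℝ)..T, (ψ s - ψ (s + h)))
      ≤ ENNReal.ofReal h * ∫⁻ s in Set.Ioi (0 : ℝ), Q s := by
    rw [intervalIntegral.integral_of_le hT.le, ofReal_integral_eq_lintegral_ofReal
      ((hi 0 T).sub hi').1 (ae_of_all _ fun s => sub_nonneg.2 (hψ (by linarith)))]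
    calc _ ≤ ∫⁻ s in Set.Ioi (0 : ℝ), ENNReal.ofReal (ψ s - ψ (s + h)) :=
          lintegral_mono_set Set.Ioc_subset_Ioi_self
      _ ≤ ∫⁻ s in Set.Ioi (0 : ℝ), ENNReal.ofReal h * Q s :=
          lintegral_mono_ae (hQ.mono fun s hs => hs h hh)
      _ = _ := lintegral_const_mul' _ _ ENNReal.ofReal_ne_top
  have h0 : ENNReal.ofReal h ≠ 0 := by simpa using hh
  rw [← ENNReal.mul_le_mul_iff_right h0 ENNReal.ofReal_ne_top, ← ENNReal.ofReal_mul hh.le]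
  exact (ENNReal.ofReal_le_ofReal key).trans hle

/-- Let `T → ∞`, then `h → 0`; continuity at `0` from the right excludes an initial jump. -/
theorem ofReal_le_lintegral_of_increment_le {ψ : ℝ → ℝ} (hψ : Antitone ψ) {Q : ℝ → ℝ≥0∞}
    (hQ : ∀ᵐ s ∂(volume.restrict (Set.Ioi (0 : ℝ))), ∀ h : ℝ, 0 < h →
      ENNReal.ofReal (ψ s - ψ (s + h)) ≤ ENNReal.ofReal h * Q s)
    (h0 : Tendsto ψ (𝓝[>] 0) (𝓝 (ψ 0))) (hT : Tendsto ψ atTop (𝓝 0)) :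
    ENNReal.ofReal (ψ 0) ≤ ∫⁻ s in Set.Ioi (0 : ℝ), Q s := by
  have h1 : ∀ h : ℝ, 0 < h → ENNReal.ofReal (ψ h) ≤ ∫⁻ s in Set.Ioi (0 : ℝ), Q s := by
    intro h hh
    have hl : Tendsto (fun T => ENNReal.ofReal (ψ h - ψ T)) atTop
        (𝓝 (ENNReal.ofReal (ψ h - 0))) :=
      ENNReal.tendsto_ofReal (tendsto_const_nhds.sub hT)
    rw [sub_zero] at hl
    refine le_of_tendsto hl ?_
    filter_upwards [eventually_gt_atTop 0] with T hT0 using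
      ofReal_sub_le_lintegral_of_increment_le hψ hQ hh hT0
  refine le_of_tendsto (ENNReal.tendsto_ofReal h0) ?_
  filter_upwards [self_mem_nhdsWithin] with h hh using h1 h hh

/-! ### Decay of the `L^p` norm, duality and the Hardy–Stein inequality. -/

namespace SymmTransitionFunction

variable {E : Type*} [MeasurableSpace E] {m : Measure E} (P : SymmTransitionFunction m)

/-- `t ↦ ∫ |P_t f|^p dm`, extended to negative times by its value at `0`. -/
noncomputable def powerNorm (p : ℝ) (f : E → ℝ) (s : ℝ) : ℝ :=
  ∫ x, |P.op s.toNNReal f x| ^ p ∂m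

theorem powerNorm_zero {p : ℝ} {f : E → ℝ} (hm : Measurable f) :
    P.powerNorm p f 0 = ∫ x, |f x| ^ p ∂m := by
  rw [powerNorm, Real.toNNReal_zero, P.op_zero hm]

theorem powerNorm_add {p : ℝ} {f : E → ℝ} (hp : 3 ≤ p) (hm : Measurable f)
    (hf : Integrable (fun x => |f x| ^ p) m) {s h : ℝ} (hs : 0 ≤ s) (hh : 0 ≤ h) :
    P.powerNorm p f (s + h) = ∫ x, |P.op h.toNNReal (P.op s.toNNReal f) x| ^ p ∂m := by
  have h1 := P.op_add (s := h.toNNReal) (t := s.toNNReal) hm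
    (P.ae_integrable_of_abs_rpow (f := f) zero_le_one (by linarith : 1 ≤ p) hm (by simp) hf _)
  rw [← Real.toNNReal_add hh hs, add_comm] at h1
  refine integral_congr_ae ?_
  filter_upwards [h1] with x hx
  rw [hx]

theorem antitone_powerNorm {p : ℝ} {f : E → ℝ} (hp : 3 ≤ p) (hm : Measurable f)
    (hf : Integrable (fun x => |f x| ^ p) m) : Antitone (P.powerNorm p f) := by
  have key : ∀ s t : ℝ, 0 ≤ s → s ≤ t → P.powerNorm p f t ≤ P.powerNorm p f s := by
    intro s t hs hst
    have h := P.powerNorm_add hp hm hf hs (sub_nonneg.2 hst)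
    rw [add_sub_cancel] at h
    rw [h]
    exact (P.integral_abs_rpow_op hp (P.measurable_op hm _)
      (P.integral_abs_rpow_op hp hm hf _).1 _).2.1
  intro s t hst
  rcases le_total 0 s with hs | hs
  · exact key s t hs hst
  · have e : P.powerNorm p f s = P.powerNorm p f 0 := by
      rw [powerNorm, powerNorm, Real.toNNReal_of_nonpos hs, Real.toNNReal_zero]
    rcases le_total 0 t with ht | ht
    · rw [e]
      exact key 0 t le_rfl ht
    · rw [e, powerNorm, powerNorm, Real.toNNReal_of_nonpos ht, Real.toNNReal_zero]

theorem ofReal_powerNorm {p : ℝ} {f : E → ℝ} (hp : 3 ≤ p) (hm : Measurable f)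
    (hf : Integrable (fun x => |f x| ^ p) m) (s : ℝ) :
    ENNReal.ofReal (P.powerNorm p f s) = ∫⁻ x, ‖P.op s.toNNReal f x‖ₑ ^ p ∂m := by
  rw [powerNorm, ofReal_integral_eq_lintegral_ofReal (P.integral_abs_rpow_op hp hm hf _).1
    (ae_of_all _ fun x => Real.rpow_nonneg (abs_nonneg _) _)]
  refine lintegral_congr fun x => ?_
  rw [← ENNReal.ofReal_rpow_of_nonneg (abs_nonneg _) (by linarith), ← Real.norm_eq_abs,
    ofReal_norm]

/-- `|P_t f|^q ≤ P_t (|f|^q)` for `q ≥ 1`. -/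
theorem enorm_op_rpow_le {q : ℝ} (hq : 1 ≤ q) {f : E → ℝ} (hm : Measurable f) (t : ℝ≥0) (x : E) :
    ‖P.op t f x‖ₑ ^ q ≤ P.opENN t (fun z => ‖f z‖ₑ ^ q) x := by
  have hq0 : 0 < q := by linarith
  have h1 : ‖P.op t f x‖ₑ ≤ ∫⁻ z, ‖f z‖ₑ ∂(P.transition t x) := enorm_integral_le_lintegral_enorm _
  have h2 := eLpNorm'_le_eLpNorm'_mul_rpow_measure_univ (p := 1) (q := q) one_pos hq
    (hm.aestronglyMeasurable (μ := P.transition t x))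
  have h3 : (P.transition t x) Set.univ ^ (1 / (1 : ℝ) - 1 / q) ≤ 1 :=
    ENNReal.rpow_le_one (P.le_one t x) (by
      rw [sub_nonneg, one_div_one, div_le_one hq0]; exact hq)
  have h4 : ‖P.op t f x‖ₑ ≤ (∫⁻ z, ‖f z‖ₑ ^ q ∂(P.transition t x)) ^ (1 / q) := by
    calc ‖P.op t f x‖ₑ ≤ eLpNorm' f 1 (P.transition t x) := by
          simpa [eLpNorm'] using h1
      _ ≤ _ := h2
      _ ≤ eLpNorm' f q (P.transition t x) * 1 := by gcongr
      _ = _ := by rw [mul_one, eLpNorm']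
  calc ‖P.op t f x‖ₑ ^ q ≤ ((∫⁻ z, ‖f z‖ₑ ^ q ∂(P.transition t x)) ^ (1 / q)) ^ q := by gcongr
    _ = _ := by
      rw [← ENNReal.rpow_mul, one_div_mul_cancel hq0.ne', ENNReal.rpow_one]
      rfl

theorem lintegral_mul_opENN_comm [SigmaFinite m] {f g : E → ℝ≥0∞} (hf : Measurable f)
    (hg : Measurable g) (t : ℝ≥0) :
    ∫⁻ x, P.opENN t f x * g x ∂m = ∫⁻ x, f x * P.opENN t g x ∂m := by
  have hF : ∀ f g : E → ℝ≥0∞, Measurable f → Measurable g →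
      ∫⁻ x, f x * P.opENN t g x ∂m = ∫⁻ z, f z.1 * g z.2 ∂(m ⊗ₘ P.transition t) := by
    intro f g hf hg
    rw [Measure.lintegral_compProd (by fun_prop)]
    refine lintegral_congr fun x => ?_
    exact (lintegral_const_mul _ hg).symm
  simp only [mul_comm (P.opENN t f _)]
  rw [hF g f hg hf, hF f g hf hg]
  nth_rewrite 1 [← P.map_swap_compProd t]
  rw [lintegral_map (by fun_prop) measurable_swap]
  simp only [Prod.fst_swap, Prod.snd_swap, mul_comm]

/-- Jensen with exponent `p - 2`, which is at least `1` because `p ≥ 3`, bounds the weight by `P_t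
|f|^{p-2}`. Symmetry moves `P_t` onto `g`, so the weight no longer depends on time and Hölder
applies with exponents `p/(p-2)` and `p/2`. -/
theorem lintegral_rpow_op_mul_le [SigmaFinite m] {p : ℝ} (hp : 3 ≤ p) {f : E → ℝ}
    (hm : Measurable f) {g : ℝ × E → ℝ≥0∞} (hg : Measurable g) :
    ∫⁻ t in Set.Ioi (0 : ℝ), ∫⁻ x, ‖P.op t.toNNReal f x‖ₑ ^ (p - 2) * g (t, x) ∂m
      ≤ (∫⁻ x, ‖f x‖ₑ ^ p ∂m) ^ ((p - 2) / p) *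
        (∫⁻ x, (∫⁻ t in Set.Ioi (0 : ℝ), P.opENN t.toNNReal (fun z => g (t, z)) x) ^ (p / 2) ∂m)
          ^ (2 / p) := by
  have hq : (1 : ℝ) ≤ p - 2 := by linarith
  have hfq : Measurable fun x => ‖f x‖ₑ ^ (p - 2) := hm.enorm.pow_const _
  have hopm : Measurable fun y : ℝ × E => P.opENN y.1.toNNReal (fun z => g (y.1, z)) y.2 := by
    have hk : Measurable fun y : ℝ × E => (y.1.toNNReal, y.2) :=
      (measurable_real_toNNReal.comp measurable_fst).prodMk measurable_snd
    have := Measurable.lintegral_kernel_prod_right' (κ := P.kernel.comap _ hk)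
      (f := fun w : (ℝ × E) × E => g (w.1.1, w.2)) (by fun_prop)
    exact this
  calc _ ≤ ∫⁻ t in Set.Ioi (0 : ℝ), ∫⁻ x, ‖f x‖ₑ ^ (p - 2) *
          P.opENN t.toNNReal (fun z => g (t, z)) x ∂m := by
        refine lintegral_mono fun t => ?_
        have hgt : Measurable fun z => g (t, z) := hg.comp measurable_prodMk_left
        simp only
        rw [← P.lintegral_mul_opENN_comm hfq hgt]
        refine lintegral_mono fun x => ?_
        gcongr
        exact P.enorm_op_rpow_le hq hm _ _
    _ = ∫⁻ x, (∫⁻ t in Set.Ioi (0 : ℝ), ‖f x‖ₑ ^ (p - 2) *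
          P.opENN t.toNNReal (fun z => g (t, z)) x) ∂m :=
        lintegral_lintegral_swap
          ((hfq.comp measurable_snd).mul hopm).aemeasurable
    _ = ∫⁻ x, ‖f x‖ₑ ^ (p - 2) *
          (∫⁻ t in Set.Ioi (0 : ℝ), P.opENN t.toNNReal (fun z => g (t, z)) x) ∂m :=
        lintegral_congr fun x => lintegral_const_mul _ (hopm.comp measurable_prodMk_right)
    _ ≤ (∫⁻ x, (‖f x‖ₑ ^ (p - 2)) ^ (p / (p - 2)) ∂m) ^ (1 / (p / (p - 2))) *
          (∫⁻ x, (∫⁻ t in Set.Ioi (0 : ℝ), P.opENN t.toNNReal (fun z => g (t, z)) x) ^ (p / 2) ∂m)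
            ^ (1 / (p / 2)) := by
        refine ENNReal.lintegral_mul_le_Lp_mul_Lq m ?_ hfq.aemeasurable
          (Measurable.lintegral_prod_left' (f := fun y : ℝ × E =>
            P.opENN y.1.toNNReal (fun z => g (y.1, z)) y.2) hopm).aemeasurable
        refine Real.holderConjugate_iff.2 ⟨?_, ?_⟩
        · rw [lt_div_iff₀ (by linarith)]; linarith
        · rw [inv_div, inv_div]; field_simp; ring
    _ = _ := by
        rw [one_div_div, one_div_div]
        congr 3
        ext x
        rw [← ENNReal.rpow_mul]
        congr 1
        field_simp

/-- Hardy–Stein inequality: for almost every time the decay of `∫ |P_s f|^p dm` is controlled by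
the jump energy of `(P_s f)^{⟨p/2⟩}`. -/
theorem IsAssociated.ae_powerNorm_sub_le [SigmaFinite m] {P : SymmTransitionFunction m}
    {𝓔 : DirichletForm m} (hP : P.IsAssociated 𝓔) {p : ℝ} (hp : 3 ≤ p) {f : E → ℝ}
    (hm : Measurable f) (hf : Integrable (fun x => |f x| ^ p) m) :
    ∀ᵐ s ∂(volume.restrict (Set.Ioi (0 : ℝ))), ∃ v : 𝓔.domain,
      ((v : Lp ℝ 2 m) : E → ℝ) =ᵐ[m] (fun x => signedPow (p / 2) (P.op s.toNNReal f x)) ∧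
      ∀ h : ℝ, 0 < h →
        P.powerNorm p f s - P.powerNorm p f (s + h) ≤ 4 * p * (h * 𝓔.form v v) := by
  have hanti := P.antitone_powerNorm hp hm hf
  -- At a point of differentiability the slope of the `L^p` decay bounds the `L²` quotients of `w`,
  -- and this puts `w` in the domain.
  have hdiff : ∀ᵐ s : ℝ, DifferentiableAt ℝ (P.powerNorm p f) s := by
    filter_upwards [hanti.neg.ae_differentiableAt] with s hs
    simpa using hs.neg
  filter_upwards [ae_restrict_of_ae hdiff, ae_restrict_mem measurableSet_Ioi] with s hs hs0
  have hs0' : (0 : ℝ) < s := hs0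
  set u : E → ℝ := P.op s.toNNReal f with hu
  have hum : Measurable u := P.measurable_op hm _
  have hup : Integrable (fun x => |u x| ^ p) m := (P.integral_abs_rpow_op hp hm hf _).1
  set w : E → ℝ := fun x => signedPow (p / 2) (u x) with hw
  have hwm : Measurable w := (measurable_signedPow _).comp hum
  have hw2 : Integrable (fun x => w x ^ 2) m := by simpa only [hw, signedPow_half_sq] using hup
  have hinc : ∀ h : ℝ≥0, ∫ x, |u x| ^ p ∂m - ∫ x, |P.op h u x| ^ p ∂m
      = P.powerNorm p f s - P.powerNorm p f (s + h) := fun h => by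
    rw [P.powerNorm_add hp hm hf hs0'.le h.coe_nonneg, Real.toNNReal_coe]
    rfl
  have hslope := hs.hasDerivAt.tendsto_slope_zero_right
  set D := deriv (P.powerNorm p f) s
  obtain ⟨δ, hδ, hδD⟩ := (mem_nhdsGT_iff_exists_Ioo_subset).1
    (hslope.eventually_const_lt (by linarith : D - 1 < D))
  have hδ' : (0 : ℝ) < δ := hδ
  have hsmall : ∀ h : ℝ≥0, 0 < h → (h : ℝ) < δ →
      (P.sqNorm w 0 - P.sqNorm w h) / h ≤ 2 * (1 - D) := by
    intro h hh hhδ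
    have hh' : (0 : ℝ) < h := hh
    have h1 : D - 1 < (h : ℝ)⁻¹ • (P.powerNorm p f (s + h) - P.powerNorm p f s) :=
      hδD ⟨hh', hhδ⟩
    have h2 := (P.integral_abs_rpow_op hp hum hup h).2.2.2
    rw [hinc] at h2
    rw [smul_eq_mul, inv_mul_eq_div, lt_div_iff₀ hh'] at h1
    rw [div_le_iff₀ hh']
    have h3 : P.sqNorm w 0 - P.sqNorm w h
      ≤ 2 * (P.powerNorm p f s - P.powerNorm p f (s + h)) := h2
    linarith
  -- The slope controls only `h < δ`; larger `h` reduce to `δ / 2`, since the quotients decrease in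
  -- `h`.
  obtain ⟨v, hv, hvle⟩ := hP.exists_mem_domain hwm hw2 (K := 2 * (1 - D)) (fun h hh => by
    rcases lt_or_ge (h : ℝ) δ with hlt | hge
    · exact hsmall h hh hlt
    · have hpos : (0 : ℝ≥0) < (δ / 2).toNNReal := by simpa using hδ'
      have hc : (((δ / 2).toNNReal : ℝ≥0) : ℝ) = δ / 2 := Real.coe_toNNReal _ (by linarith)
      refine (P.sqNorm_quotient_le hwm hw2 hpos ?_).trans
        (hsmall _ hpos (by rw [hc]; linarith))
      rw [← NNReal.coe_le_coe, hc]
      linarith)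
  refine ⟨v, hv, fun h hh => ?_⟩
  have h1 := (P.integral_abs_rpow_op hp hum hup h.toNNReal).2.2.1
  have h2 := hvle h.toNNReal
  rw [hinc] at h1
  rw [Real.coe_toNNReal _ hh.le] at h1 h2
  -- The constant `4p` is `2p` from the Jensen gap times `2` from the doubled time.
  have h3 := mul_le_mul_of_nonneg_left h2 (by linarith : 0 ≤ 2 * p)
  have h1' : P.powerNorm p f s - P.powerNorm p f (s + h)
    ≤ 2 * p * (P.sqNorm w 0 - P.sqNorm w h.toNNReal) := h1
  linarith

/-- The `L^p` decay is at most `2p` times the `L²` decay of the signed power, and `P_t` is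
continuous at `0` on `L²`. -/
theorem IsAssociated.tendsto_powerNorm_zero [SigmaFinite m] {P : SymmTransitionFunction m}
    {𝓔 : DirichletForm m} (hP : P.IsAssociated 𝓔) {p : ℝ} (hp : 3 ≤ p) {f : E → ℝ}
    (hm : Measurable f) (hf : Integrable (fun x => |f x| ^ p) m) :
    Tendsto (P.powerNorm p f) (𝓝[>] 0) (𝓝 (P.powerNorm p f 0)) := by
  set w : E → ℝ := fun x => signedPow (p / 2) (f x) with hw
  have hwm : Measurable w := (measurable_signedPow _).comp hm
  have hw2 : Integrable (fun x => w x ^ 2) m := by simpa only [hw, signedPow_half_sq] using hf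
  have hr : Tendsto Real.toNNReal (𝓝[>] 0) (𝓝[>] 0) := by
    refine tendsto_nhdsWithin_iff.2 ⟨?_, ?_⟩
    · have : Tendsto Real.toNNReal (𝓝 0) (𝓝 (Real.toNNReal 0)) := continuous_real_toNNReal.tendsto 0
      rw [Real.toNNReal_zero] at this
      exact this.mono_left nhdsWithin_le_nhds
    · filter_upwards [self_mem_nhdsWithin] with h hh
      exact Real.toNNReal_pos.2 hh
  have hl := ((hP.tendsto_sqNorm hwm hw2).comp hr).const_mul (2 * p)
  rw [mul_zero] at hl
  have h1 : Tendsto (fun h => P.powerNorm p f 0 - P.powerNorm p f h) (𝓝[>] 0) (𝓝 0) := by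
    refine squeeze_zero' ?_ ?_ hl
    · filter_upwards [self_mem_nhdsWithin] with h hh
      exact sub_nonneg.2 (P.antitone_powerNorm hp hm hf (le_of_lt hh))
    · refine Eventually.of_forall fun h => ?_
      rw [P.powerNorm_zero hm]
      exact (P.integral_abs_rpow_op hp hm hf h.toNNReal).2.2.1
  have h2 := (tendsto_const_nhds (x := P.powerNorm p f 0)).sub h1
  simpa using h2

end SymmTransitionFunction

/-! ### The energy as an integral over pairs, and measurable versions. -/

/-- Null sets in the first coordinate are harmless by construction, and symmetry carries this to the
second. Versions may therefore be changed inside the jump energy. -/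
theorem ae_fst_snd_of_map_swap_eq {E : Type*} [MeasurableSpace E] {m : Measure E} [SFinite m]
    {J : Kernel E E} [IsSFiniteKernel J] (hJ : (m ⊗ₘ J).map Prod.swap = m ⊗ₘ J) {q : E → Prop}
    (hq : ∀ᵐ x ∂m, q x) : ∀ᵐ z ∂(m ⊗ₘ J), q z.1 ∧ q z.2 := by
  obtain ⟨N, hqN, hN, hN0⟩ := exists_measurable_superset_of_null (ae_iff.1 hq)
  have h1 : ∀ᵐ z ∂(m ⊗ₘ J), z.1 ∉ N :=
    Measure.ae_compProd_of_ae_fst J hN.compl (measure_eq_zero_iff_ae_notMem.1 hN0)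
  have h2 : ∀ᵐ z ∂(m ⊗ₘ J), z.2 ∉ N := by
    rw [← hJ, ae_map_iff measurable_swap.aemeasurable
      (show MeasurableSet {z : E × E | z.2 ∉ N} from measurable_snd hN.compl)]
    exact h1
  filter_upwards [h1, h2] with z hz1 hz2
  exact ⟨by_contra fun h => hz1 (hqN h), by_contra fun h => hz2 (hqN h)⟩

theorem DirichletForm.IsPureJump.ofReal_form_eq {E : Type*} [TopologicalSpace E]
    [MeasurableSpace E] {m : Measure E} [SFinite m] {𝓔 : DirichletForm m} {J : Kernel E E}
    (hJ : 𝓔.IsPureJump J) {J' : Kernel E E} [IsSFiniteKernel J']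
    (hJ' : ∀ᵐ x ∂m, J' x = (J x).restrict {x}ᶜ) (hsymm : (m ⊗ₘ J').map Prod.swap = m ⊗ₘ J')
    {w : E → ℝ} {v : 𝓔.domain} (hv : ((v : Lp ℝ 2 m) : E → ℝ) =ᵐ[m] w) :
    ENNReal.ofReal (𝓔.form v v)
      = 1 / 2 * ∫⁻ z, ENNReal.ofReal ((w z.2 - w z.1) ^ 2) ∂(m ⊗ₘ J') := by
  have hm : Measurable ((v : Lp ℝ 2 m) : E → ℝ) := (Lp.stronglyMeasurable _).measurable
  rw [hJ.form_eq v]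
  congr 1
  calc _ = ∫⁻ x, ∫⁻ y, ENNReal.ofReal (((v : Lp ℝ 2 m) y - (v : Lp ℝ 2 m) x) ^ 2) ∂(J' x) ∂m := by
        refine lintegral_congr_ae ?_
        filter_upwards [hJ'] with x hx
        rw [hx]
    _ = ∫⁻ z, ENNReal.ofReal (((v : Lp ℝ 2 m) z.2 - (v : Lp ℝ 2 m) z.1) ^ 2) ∂(m ⊗ₘ J') :=
        (Measure.lintegral_compProd (f := fun z : E × E =>
          ENNReal.ofReal (((v : Lp ℝ 2 m) z.2 - (v : Lp ℝ 2 m) z.1) ^ 2)) (by fun_prop)).symm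
    _ = _ := by
        refine lintegral_congr_ae ?_
        filter_upwards [ae_fst_snd_of_map_swap_eq hsymm hv] with z hz
        rw [hz.1, hz.2]

namespace SymmTransitionFunction

variable {E : Type*} [MeasurableSpace E] {m : Measure E} {P : SymmTransitionFunction m}

/-- The Hardy–Stein inequality integrated over all times. The constant is `4p · 2p²`; the factor
`1/2` of the form is discarded. -/
theorem IsAssociated.lintegral_rpow_le [TopologicalSpace E] [SigmaFinite m] {𝓔 : DirichletForm m}
    (hP : P.IsAssociated 𝓔) {J : Kernel E E} (hJ : 𝓔.IsPureJump J) {J' : Kernel E E}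
    [IsSFiniteKernel J'] (hJ' : ∀ᵐ x ∂m, J' x = (J x).restrict {x}ᶜ)
    (hsymm : (m ⊗ₘ J').map Prod.swap = m ⊗ₘ J') {p : ℝ} (hp : 3 ≤ p)
    (hstable : P.StronglyStable (ENNReal.ofReal p)) {f : E → ℝ} (hm : Measurable f)
    (hf : MemLp f (ENNReal.ofReal p) m) :
    ∫⁻ x, ‖f x‖ₑ ^ p ∂m ≤ ENNReal.ofReal (8 * p ^ 3) * ∫⁻ t in Set.Ioi (0 : ℝ),
      ∫⁻ z, ‖P.op t.toNNReal f z.1‖ₑ ^ (p - 2) *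
        tildeDensity (P.op t.toNNReal f z.1) (P.op t.toNNReal f z.2) ∂(m ⊗ₘ J') := by
  have hp0 : 0 < p := by linarith
  have hpe : ENNReal.ofReal p ≠ 0 := by simpa using hp0
  have htr : (ENNReal.ofReal p).toReal = p := ENNReal.toReal_ofReal hp0.le
  have hfi : Integrable (fun x => |f x| ^ p) m := by
    have := hf.integrable_norm_rpow hpe ENNReal.ofReal_ne_top
    rwa [htr] at this
  set R : ℝ → ℝ≥0∞ := fun t => ∫⁻ z, ‖P.op t.toNNReal f z.1‖ₑ ^ (p - 2) *
        tildeDensity (P.op t.toNNReal f z.1) (P.op t.toNNReal f z.2) ∂(m ⊗ₘ J') with hR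
  have hinc : ∀ᵐ s ∂(volume.restrict (Set.Ioi (0 : ℝ))), ∀ h : ℝ, 0 < h →
      ENNReal.ofReal (P.powerNorm p f s - P.powerNorm p f (s + h))
        ≤ ENNReal.ofReal h * (ENNReal.ofReal (8 * p ^ 3) * R s) := by
    filter_upwards [hP.ae_powerNorm_sub_le hp hm hfi] with s hs h hh
    obtain ⟨v, hv, hle⟩ := hs
    have hform := hJ.ofReal_form_eq hJ' hsymm hv
    have hQ := lintegral_signedPow_sub_sq_le hsymm hp (P.measurable_op hm s.toNNReal)
    calc _ ≤ ENNReal.ofReal (4 * p * (h * 𝓔.form v v)) := ENNReal.ofReal_le_ofReal (hle h hh)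
      _ = ENNReal.ofReal h * (ENNReal.ofReal (4 * p) * ENNReal.ofReal (𝓔.form v v)) := by
          rw [ENNReal.ofReal_mul (by positivity), ENNReal.ofReal_mul hh.le]
          ring
      _ ≤ ENNReal.ofReal h * (ENNReal.ofReal (4 * p) * (ENNReal.ofReal (2 * p ^ 2) * R s)) := by
          gcongr
          rw [hform]
          refine le_trans (mul_le_of_le_one_left zero_le ?_) hQ
          rw [one_div, ENNReal.inv_le_one]
          exact one_le_two
      _ = _ := by
          rw [← mul_assoc (ENNReal.ofReal (4 * p)), ← ENNReal.ofReal_mul (by positivity)]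
          congr 3
          ring
  have hlim : Tendsto (P.powerNorm p f) atTop (𝓝 0) := by
    have h1 := (hstable f hf).comp tendsto_real_toNNReal_atTop
    have h2 := ((ENNReal.continuous_rpow_const (y := p)).tendsto 0).comp h1
    rw [ENNReal.zero_rpow_of_pos hp0] at h2
    have h3 : ∀ s : ℝ, P.powerNorm p f s = ENNReal.toReal
        (eLpNorm (P.op s.toNNReal f) (ENNReal.ofReal p) m ^ p) := fun s => by
      rw [eLpNorm_eq_lintegral_rpow_enorm_toReal hpe ENNReal.ofReal_ne_top, htr,
        ← ENNReal.rpow_mul, one_div_mul_cancel hp0.ne', ENNReal.rpow_one,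
        ← P.ofReal_powerNorm hp hm hfi, ENNReal.toReal_ofReal]
      exact integral_nonneg fun x => Real.rpow_nonneg (abs_nonneg _) _
    have h4 := (ENNReal.tendsto_toReal ENNReal.zero_ne_top).comp h2
    rw [ENNReal.toReal_zero] at h4
    exact h4.congr fun s => (h3 s).symm
  have h := ofReal_le_lintegral_of_increment_le (P.antitone_powerNorm hp hm hfi) hinc
    (hP.tendsto_powerNorm_zero hp hm hfi) hlim
  rw [P.ofReal_powerNorm hp hm hfi, Real.toNNReal_zero, P.op_zero hm,
    lintegral_const_mul' _ _ ENNReal.ofReal_ne_top] at h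
  exact h

/-- A jointly measurable minorant of `(t, x) ↦ Γ̃[P_t f](x)` that is computed from a measurable
version `f'` of `f` and does not lose energy. -/
theorem exists_measurable_minorant [SFinite m] {J J' : Kernel E E} [IsSFiniteKernel J']
    (hle : ∀ x, J' x ≤ (J x).restrict {x}ᶜ) (hsymm : (m ⊗ₘ J').map Prod.swap = m ⊗ₘ J')
    {f f' : E → ℝ} (hm : Measurable f') (hff' : f =ᵐ[m] f') (q : ℝ) :
    ∃ g : ℝ × E → ℝ≥0∞, Measurable g ∧
      (∀ t x, g (t, x) ≤ carreDuChampTilde J (P.op t.toNNReal f) x) ∧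
      ∀ t : ℝ, ∫⁻ x, ‖P.op t.toNNReal f' x‖ₑ ^ q * g (t, x) ∂m
        = ∫⁻ z, ‖P.op t.toNNReal f' z.1‖ₑ ^ q *
          tildeDensity (P.op t.toNNReal f' z.1) (P.op t.toNNReal f' z.2) ∂(m ⊗ₘ J') := by
  obtain ⟨N, hN, hNm, hN0⟩ := exists_measurable_superset_of_null (ae_iff.1 hff')
  -- `P_t f` and `P_t f'` agree at any point with `P_t(x, N) = 0`. Requiring this at both ends makes
  -- the minorant valid everywhere, and for each `t` it discards only a null set of pairs.
  set G : Set ((ℝ × E) × E) := {w | P.kernel (w.1.1.toNNReal, w.1.2) N = 0 ∧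
    P.kernel (w.1.1.toNNReal, w.2) N = 0} with hG
  have hκ := P.kernel.measurable_coe hNm
  have hGm : MeasurableSet G :=
    (hκ.comp (by fun_prop : Measurable fun w : (ℝ × E) × E => (w.1.1.toNNReal, w.1.2))
      (measurableSet_singleton 0)).inter
    (hκ.comp (by fun_prop : Measurable fun w : (ℝ × E) × E => (w.1.1.toNNReal, w.2))
      (measurableSet_singleton 0))
  have hu := P.measurable_op_uncurry hm
  have hD : Measurable fun w : (ℝ × E) × E =>
      tildeDensity (P.op w.1.1.toNNReal f' w.1.2) (P.op w.1.1.toNNReal f' w.2) :=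
    Measurable.tildeDensity
      (hu.comp (by fun_prop : Measurable fun w : (ℝ × E) × E => (w.1.1.toNNReal, w.1.2)))
      (hu.comp (by fun_prop : Measurable fun w : (ℝ × E) × E => (w.1.1.toNNReal, w.2)))
  set K : (ℝ × E) × E → ℝ≥0∞ := G.indicator fun w =>
    tildeDensity (P.op w.1.1.toNNReal f' w.1.2) (P.op w.1.1.toNNReal f' w.2) with hK
  have hKm : Measurable K := hD.indicator hGm
  have hop : ∀ (t : ℝ≥0) (x : E), P.kernel (t, x) N = 0 → P.op t f x = P.op t f' x :=
    fun t x h => integral_congr_ae (ae_iff.2 (measure_mono_null hN h))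
  refine ⟨fun y => ∫⁻ z, K (y, z) ∂(J' y.2),
    Measurable.lintegral_kernel_prod_right' (κ := J'.comap Prod.snd measurable_snd) hKm,
    fun t x => ?_, fun t => ?_⟩
  · refine (lintegral_mono' (hle x) (le_refl _)).trans (lintegral_mono fun y => ?_)
    simp only [hK, Set.indicator]
    split_ifs with h
    · rw [tildeDensity, hop _ _ h.1, hop _ _ h.2]
    · exact zero_le
  · have hut : Measurable (P.op t.toNNReal f') := P.measurable_op hm _
    have h1 : Measurable fun z : E × E => ‖P.op t.toNNReal f' z.1‖ₑ ^ q * K ((t, z.1), z.2) :=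
      ((hut.comp measurable_fst).enorm.pow_const _).mul (hKm.comp (by fun_prop))
    have hgood : ∀ᵐ x ∂m, P.kernel (t.toNNReal, x) N = 0 :=
      P.ae_ae_transition (measure_eq_zero_iff_ae_notMem.1 hN0) t.toNNReal |>.mono fun x hx =>
        measure_eq_zero_iff_ae_notMem.2 hx
    calc _ = ∫⁻ x, ∫⁻ y, ‖P.op t.toNNReal f' x‖ₑ ^ q * K ((t, x), y) ∂(J' x) ∂m :=
          lintegral_congr fun x => (lintegral_const_mul _ (hKm.comp measurable_prodMk_left)).symm
      _ = ∫⁻ z, ‖P.op t.toNNReal f' z.1‖ₑ ^ q * K ((t, z.1), z.2) ∂(m ⊗ₘ J') :=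
          (Measure.lintegral_compProd h1).symm
      _ = _ := by
          refine lintegral_congr_ae ?_
          filter_upwards [ae_fst_snd_of_map_swap_eq hsymm hgood] with z hz
          rw [hK, Set.indicator_of_mem (show ((t, z.1), z.2) ∈ G from hz)]

theorem opENN_mono {g h : E → ℝ≥0∞} (hgh : ∀ x, g x ≤ h x) (t : ℝ≥0) (x : E) :
    P.opENN t g x ≤ P.opENN t h x := lintegral_mono hgh

theorem opENN_const_mul (c : ℝ≥0∞) (hc : c ≠ ∞) (g : E → ℝ≥0∞) (t : ℝ≥0) (x : E) :
    P.opENN t (fun z => c * g z) x = c * P.opENN t g x := lintegral_const_mul' _ _ hc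

end SymmTransitionFunction

/-! ### Comparison of the square functions and conclusion. -/

theorem carreDuChampTilde_le {E : Type*} [MeasurableSpace E] (J : Kernel E E) (u : E → ℝ) (x : E) :
    carreDuChampTilde J u x ≤ 2 * carreDuChamp J u x := by
  rw [carreDuChamp, ← mul_assoc, one_div, ENNReal.mul_inv_cancel two_ne_zero ENNReal.ofNat_ne_top,
    one_mul]
  refine lintegral_mono fun y => ENNReal.ofReal_le_ofReal ?_
  exact mul_le_of_le_one_right (sq_nonneg _) (chi_le_one _ _)

theorem squareHTilde_le {E : Type*} [MeasurableSpace E] {m : Measure E}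
    (P : SymmTransitionFunction m) (J : Kernel E E) (f : E → ℝ) (x : E) :
    squareHTilde P J f x ≤ ENNReal.ofReal (Real.sqrt 2) * squareH P J f x := by
  have h2 : ENNReal.ofReal (Real.sqrt 2) = (2 : ℝ≥0∞) ^ (1 / 2 : ℝ) := by
    rw [Real.sqrt_eq_rpow, ← ENNReal.ofReal_rpow_of_nonneg zero_le_two (by norm_num),
      ENNReal.ofReal_ofNat]
  rw [h2, squareH, squareHTilde, ← ENNReal.mul_rpow_of_nonneg _ _ (by norm_num : (0 : ℝ) ≤ 1 / 2),
    ← lintegral_const_mul' _ _ ENNReal.ofNat_ne_top]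
  gcongr with t
  rw [← P.opENN_const_mul 2 ENNReal.ofNat_ne_top]
  exact P.opENN_mono (fun y => carreDuChampTilde_le J _ y) _ _

/-- Cancel `A^{(p-2)/p}`, which is legitimate because `A` is finite, and take square roots. -/
theorem ENNReal.rpow_le_of_le_mul_rpow {p : ℝ} (hp : 3 ≤ p) {A B C : ℝ≥0∞} (hA : A ≠ ∞)
    (h : A ≤ C * (A ^ ((p - 2) / p) * B ^ (2 / p))) :
    A ^ (1 / p) ≤ C ^ (1 / 2 : ℝ) * B ^ (1 / p) := by
  have hp0 : 0 < p := by linarith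
  rcases eq_or_ne A 0 with rfl | hA0
  · rw [ENNReal.zero_rpow_of_pos (by positivity)]
    exact zero_le
  have hx0 : A ^ ((p - 2) / p) ≠ 0 := by
    rw [Ne, ENNReal.rpow_eq_zero_iff]
    push Not
    exact ⟨fun h => absurd h hA0, fun h => absurd h hA⟩
  have hxt : A ^ ((p - 2) / p) ≠ ∞ :=
    ENNReal.rpow_ne_top_of_nonneg (div_nonneg (by linarith) hp0.le) hA
  have e : A ^ ((p - 2) / p) * A ^ (2 / p) = A := by
    rw [← ENNReal.rpow_add _ _ hA0 hA, ← add_div, sub_add_cancel, div_self hp0.ne',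
      ENNReal.rpow_one]
  have h' : A ^ ((p - 2) / p) * A ^ (2 / p) ≤ A ^ ((p - 2) / p) * (C * B ^ (2 / p)) := by
    rw [e]
    calc A ≤ _ := h
      _ = _ := by ring
  rw [ENNReal.mul_le_mul_iff_right hx0 hxt] at h'
  have h2 := ENNReal.rpow_le_rpow h' (by norm_num : (0 : ℝ) ≤ 1 / 2)
  rw [ENNReal.mul_rpow_of_nonneg _ _ (by norm_num : (0 : ℝ) ≤ 1 / 2), ← ENNReal.rpow_mul,
    ← ENNReal.rpow_mul, show 2 / p * (1 / 2) = 1 / p by field_simp] at h2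
  exact h2

/-- The lower square function estimate `‖f‖_p ≤ C_p ‖H̃‖_p`. -/
theorem eLpNorm_le_mul_eLpNorm_squareHTilde {p : ℝ} (hp : 3 ≤ p) {E : Type*} [TopologicalSpace E]
    [T2Space E] [LocallyCompactSpace E] [SecondCountableTopology E] [MeasurableSpace E]
    [BorelSpace E] {m : Measure E} [SigmaFinite m] {𝓔 : DirichletForm m} {J : Kernel E E}
    {P : SymmTransitionFunction m} (hJ : 𝓔.IsPureJump J) (hP : P.IsAssociated 𝓔)
    (hstable : P.StronglyStable (ENNReal.ofReal p)) {f : E → ℝ}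
    (hf : MemLp f (ENNReal.ofReal p) m) :
    eLpNorm f (ENNReal.ofReal p) m ≤ ENNReal.ofReal (8 * p ^ 3) ^ (1 / 2 : ℝ) *
      eLpNorm (squareHTilde P J f) (ENNReal.ofReal p) m := by
  have hp0 : 0 < p := by linarith
  have hpe : ENNReal.ofReal p ≠ 0 := by simpa using hp0
  have htr : (ENNReal.ofReal p).toReal = p := ENNReal.toReal_ofReal hp0.le
  obtain ⟨J', hJs, hle, hJ', hsymm⟩ := hJ.exists_offDiagonal_kernel
  set f' := hf.1.mk f with hf'
  have hff' : f =ᵐ[m] f' := hf.1.ae_eq_mk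
  have hm : Measurable f' := hf.1.stronglyMeasurable_mk.measurable
  have hfp : MemLp f' (ENNReal.ofReal p) m := hf.ae_eq hff'
  obtain ⟨g, hg, hgle, hgint⟩ :=
    SymmTransitionFunction.exists_measurable_minorant (P := P) hle hsymm hm hff' (p - 2)
  have h1 := hP.lintegral_rpow_le hJ hJ' hsymm hp hstable hm hfp
  simp only [← hgint] at h1
  have h2 := P.lintegral_rpow_op_mul_le hp hm hg
  -- Only monotonicity of the integrals is used, so `H̃` need not be measurable.
  have hB : ∫⁻ x, (∫⁻ t in Set.Ioi (0 : ℝ), P.opENN t.toNNReal (fun z => g (t, z)) x) ^ (p / 2) ∂m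
      ≤ ∫⁻ x, squareHTilde P J f x ^ p ∂m := by
    refine lintegral_mono fun x => ?_
    simp only [squareHTilde]
    rw [← ENNReal.rpow_mul, show 1 / 2 * p = p / 2 by ring]
    gcongr with t
    exact P.opENN_mono (fun z => hgle t z) _ _
  have hA : ∫⁻ x, ‖f' x‖ₑ ^ p ∂m ≠ ∞ := by
    have := lintegral_rpow_enorm_lt_top_of_eLpNorm_lt_top hpe ENNReal.ofReal_ne_top hfp.2
    rw [htr] at this
    exact this.ne
  rw [eLpNorm_congr_ae hff', eLpNorm_eq_lintegral_rpow_enorm_toReal hpe ENNReal.ofReal_ne_top,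
    eLpNorm_eq_lintegral_rpow_enorm_toReal hpe ENNReal.ofReal_ne_top, htr]
  simp only [enorm_eq_self]
  refine ENNReal.rpow_le_of_le_mul_rpow hp hA (h1.trans ?_)
  gcongr
  refine h2.trans ?_
  gcongr

theorem eLpNorm_squareHTilde_le {p : ℝ} (hp : 0 < p) {E : Type*} [MeasurableSpace E]
    {m : Measure E} (P : SymmTransitionFunction m) (J : Kernel E E) (f : E → ℝ) :
    eLpNorm (squareHTilde P J f) (ENNReal.ofReal p) m
      ≤ ENNReal.ofReal (Real.sqrt 2) * eLpNorm (squareH P J f) (ENNReal.ofReal p) m := by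
  have hpe : ENNReal.ofReal p ≠ 0 := by simpa using hp
  rw [eLpNorm_eq_lintegral_rpow_enorm_toReal hpe ENNReal.ofReal_ne_top,
    eLpNorm_eq_lintegral_rpow_enorm_toReal hpe ENNReal.ofReal_ne_top,
    ENNReal.toReal_ofReal hp.le]
  simp only [enorm_eq_self]
  have hc : ENNReal.ofReal (Real.sqrt 2) ^ p ≠ ∞ :=
    ENNReal.rpow_ne_top_of_nonneg hp.le ENNReal.ofReal_ne_top
  calc _ ≤ (∫⁻ x, ENNReal.ofReal (Real.sqrt 2) ^ p * squareH P J f x ^ p ∂m) ^ (1 / p) := by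
        gcongr with x
        rw [← ENNReal.mul_rpow_of_nonneg _ _ hp.le]
        gcongr
        exact squareHTilde_le P J f x
    _ = _ := by
        rw [lintegral_const_mul' _ _ hc, ENNReal.mul_rpow_of_nonneg _ _ (by positivity),
          ← ENNReal.rpow_mul, mul_one_div_cancel hp.ne', ENNReal.rpow_one]

theorem proposition4p8 (p : ℝ) (hp : 3 ≤ p) :
    ∃ C : ℝ≥0, 0 < C ∧
      ∀ (E : Type*) [MetricSpace E] [LocallyCompactSpace E] [TopologicalSpace.SeparableSpace E]
        [MeasurableSpace E] [BorelSpace E]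
        (m : Measure E) [IsFiniteMeasureOnCompacts m] [m.IsOpenPosMeasure]
        (𝓔 : DirichletForm m) (J : Kernel E E) (P : SymmTransitionFunction m),
        𝓔.IsRegular → 𝓔.IsPureJump J → P.IsAssociated 𝓔 →
        P.StronglyStable (ENNReal.ofReal p) →
        ∀ f : E → ℝ, MemLp f (ENNReal.ofReal p) m →
          eLpNorm f (ENNReal.ofReal p) m
              ≤ C * eLpNorm (squareHTilde P J f) (ENNReal.ofReal p) m ∧
          (∀ x, squareHTilde P J f x ≤ ENNReal.ofReal (Real.sqrt 2) * squareH P J f x) ∧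
          eLpNorm f (ENNReal.ofReal p) m
              ≤ C * eLpNorm (squareH P J f) (ENNReal.ofReal p) m := by
  have hp0 : 0 < p := by linarith
  set c : ℝ := (8 * p ^ 3) ^ (1 / 2 : ℝ) with hc
  have hc0 : 0 < c := by positivity
  have hcE : ENNReal.ofReal c = ENNReal.ofReal (8 * p ^ 3) ^ (1 / 2 : ℝ) :=
    (ENNReal.ofReal_rpow_of_nonneg (by positivity) (by norm_num)).symm
  have h2 : (1 : ℝ) ≤ Real.sqrt 2 := Real.one_le_sqrt.2 one_le_two
  -- The factor `√2` is needed for `H`; being at least `1`, it does no harm for `H̃`.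
  refine ⟨(c * Real.sqrt 2).toNNReal, Real.toNNReal_pos.2 (by positivity), ?_⟩
  intro E _ _ _ _ _ m _ _ 𝓔 J P _ hJ hP hstable f hf
  have : SecondCountableTopology E := UniformSpace.secondCountable_of_separable E
  have key := eLpNorm_le_mul_eLpNorm_squareHTilde hp hJ hP hstable hf
  rw [← hcE] at key
  refine ⟨key.trans ?_, squareHTilde_le P J f, key.trans ?_⟩
  · gcongr
    exact ENNReal.ofReal_le_ofReal (le_mul_of_one_le_right hc0.le h2)
  · calc _ ≤ ENNReal.ofReal c * (ENNReal.ofReal (Real.sqrt 2) *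
          eLpNorm (squareH P J f) (ENNReal.ofReal p) m) := by
          gcongr
          exact eLpNorm_squareHTilde_le hp0 P J f
      _ = _ := by
          rw [← mul_assoc, ← ENNReal.ofReal_mul hc0.le]
          rfl
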